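/- An instance consists of a finite directed graph $D=(V,E)$ (parallel edges and loops are allowed), two vertices $s,t\in V$, a length function $\ell:E\to\mathbb Z_{>0}$, a weight function $w:E\to\mathbb Z_{\ge 0}$, and an integer $k\ge 1$. Let $\mathcal P$ be the set of all shortest paths from $s$ to $t$ in $(D,\ell)$, where a path visits no vertex twice. For finite sets $S_1,\dots,S_k\subseteq E$ let $$d_w(S_1,\dots,S_k)=\sum_{1\le i<j\le k}\ \sum_{e\in S_i\triangle S_j} w(e).$$ The problem *Diverse Shortest $st$-Paths* asks for $k$ (not necessarily distinct) paths $P_1,\dots,P_k\in\mathcal P$ that maximise $d_w(E(P_1),\dots,E(P_k))$, or for the answer that $D$ has no path from $s$ to $t$. **Theorem.** Diverse Shortest $st$-Paths can be solved in $O(k^2|E|^2\log^2|V|)$ time. Precisely: there are a single random access machine program and a constant $C$ such that, on every instance, given as a list of edges with their lengths and weights, the program halts with a correct answer, and if $|E|\ge 1$ and $|V|\ge 2$ it does so after at most $C\,k^2|E|^2\log^2|V|$ steps. Each assignment of a constant, addition, subtraction or comparison of two integers, and each indirect read or write of a memory cell, is one step; the machine has no multiplication or division. -/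

import Mathlib

/-! ### Unit-cost random access machine -/

namespace Ram

/-- A configuration: integer registers and an integer memory addressed by integers. -/
structure State where
  reg : ℕ → ℤ
  mem : ℤ → ℤ

/-- The primitive operations. There is no multiplication or division, so that a computation of
`T` steps lengthens the binary representation of a number by at most `T` bits. -/
inductive Op where
  /-- `reg a := c` -/
  | const (a : ℕ) (c : ℤ)
  /-- `reg a := reg b + reg c` -/
  | add (a b c : ℕ)
  /-- `reg a := reg b - reg c` -/
  | sub (a b c : ℕ)
  /-- `reg a := mem (reg b)` -/
  | load (a b : ℕ)
  /-- `mem (reg a) := reg b` -/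
  | store (a b : ℕ)

/-- The effect of a primitive operation. -/
def Op.apply : Op → State → State
  | .const a c, σ => { σ with reg := Function.update σ.reg a c }
  | .add a b c, σ => { σ with reg := Function.update σ.reg a (σ.reg b + σ.reg c) }
  | .sub a b c, σ => { σ with reg := Function.update σ.reg a (σ.reg b - σ.reg c) }
  | .load a b, σ => { σ with reg := Function.update σ.reg a (σ.mem (σ.reg b)) }
  | .store a b, σ => { σ with mem := Function.update σ.mem (σ.reg a) (σ.reg b) }

/-- The tests that control branching: comparisons of two registers. -/
inductive Test where
  | lt (a b : ℕ)
  | eq (a b : ℕ)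

/-- The truth of a test in a configuration. -/
def Test.Holds : Test → State → Prop
  | .lt a b, σ => σ.reg a < σ.reg b
  | .eq a b, σ => σ.reg a = σ.reg b

/-- Programs. A program is a finite object; it mentions finitely many registers. -/
inductive Prog where
  | op (o : Op)
  | seq (p q : Prog)
  | ite (c : Test) (p q : Prog)
  | while (c : Test) (p : Prog)

/-- `Exec p σ T τ`: started in `σ`, the program `p` halts in `τ` after exactly `T` steps, where
every primitive operation and every evaluation of a test is one step. -/
inductive Exec : Prog → State → ℕ → State → Prop where
  | op (o : Op) (σ : State) : Exec (.op o) σ 1 (o.apply σ)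
  | seq {p q : Prog} {σ τ ρ : State} {T₁ T₂ : ℕ} :
      Exec p σ T₁ τ → Exec q τ T₂ ρ → Exec (.seq p q) σ (T₁ + T₂) ρ
  | ite_true {c : Test} {p q : Prog} {σ τ : State} {T : ℕ} :
      c.Holds σ → Exec p σ T τ → Exec (.ite c p q) σ (T + 1) τ
  | ite_false {c : Test} {p q : Prog} {σ τ : State} {T : ℕ} :
      ¬ c.Holds σ → Exec q σ T τ → Exec (.ite c p q) σ (T + 1) τ
  | while_true {c : Test} {p : Prog} {σ τ ρ : State} {T₁ T₂ : ℕ} :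
      c.Holds σ → Exec p σ T₁ τ → Exec (.while c p) τ T₂ ρ →
        Exec (.while c p) σ (T₁ + T₂ + 1) ρ
  | while_false {c : Test} {p : Prog} {σ : State} :
      ¬ c.Holds σ → Exec (.while c p) σ 1 σ

/-- The list `L` is written in consecutive memory cells from address `a` on. -/
def State.WrittenAt (σ : State) (a : ℤ) (L : List ℤ) : Prop :=
  ∀ i : Fin L.length, σ.mem (a + (i : ℕ)) = L.get i

end Ram

/-! ### The problem Diverse Shortest st-Paths -/

/-- `d_w(S_1, …, S_k)`: the sum over `i < j` of the weight of the symmetric difference of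
`S_i` and `S_j`. -/
def weightedDiversity {U : Type*} [DecidableEq U] (w : U → ℤ) {k : ℕ}
    (S : Fin k → Finset U) : ℤ :=
  ∑ i : Fin k, ∑ j ∈ Finset.univ.filter (fun j : Fin k => i < j),
    ∑ e ∈ symmDiff (S i) (S j), w e

/-- An instance: a directed graph with vertices `0, …, n - 1` and edges `0, …, m - 1`
(parallel edges and loops are allowed), positive integer edge lengths, integer edge weights, two
vertices `s`, `t`, and the number `k` of paths asked for. -/
structure DSPInstance where
  n : ℕ
  m : ℕ
  src : Fin m → Fin n
  tgt : Fin m → Fin n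
  len : Fin m → ℕ
  len_pos : ∀ e, 0 < len e
  wt : Fin m → ℤ
  s : Fin n
  t : Fin n
  k : ℕ

namespace DSPInstance

variable (I : DSPInstance)

/-- `I.IsWalk u p v`: the edges in the list `p` form a directed walk from `u` to `v`. -/
def IsWalk : Fin I.n → List (Fin I.m) → Fin I.n → Prop
  | u, [], v => u = v
  | u, e :: p, v => I.src e = u ∧ IsWalk (I.tgt e) p v

/-- An `s`-`t` path, given by its edges in order: a walk that visits no vertex twice. -/
def IsPath (p : List (Fin I.m)) : Prop :=
  I.IsWalk I.s p I.t ∧ (I.s :: p.map I.tgt).Nodup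

/-- The length of a path. -/
def length (p : List (Fin I.m)) : ℕ := (p.map I.len).sum

/-- The shortest `s`-`t` paths. -/
def IsShortestPath (p : List (Fin I.m)) : Prop :=
  I.IsPath p ∧ ∀ q, I.IsPath q → I.length p ≤ I.length q

/-- The diversity of a `k`-tuple of paths. -/
def diversity (P : Fin I.k → List (Fin I.m)) : ℤ :=
  weightedDiversity I.wt fun i => (P i).toFinset

/-- An optimal solution: `k` shortest paths (not necessarily distinct) of maximum diversity. -/
def IsOptimal (P : Fin I.k → List (Fin I.m)) : Prop :=
  (∀ i, I.IsShortestPath (P i)) ∧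
    ∀ Q : Fin I.k → List (Fin I.m), (∀ i, I.IsShortestPath (Q i)) → I.diversity Q ≤ I.diversity P

/-- The input as a list of integers: `n, m, s, t, k`, and then, for each edge, its source, its
target, its length and its weight. -/
def encode : List ℤ :=
  [(I.n : ℤ), (I.m : ℤ), ((I.s : ℕ) : ℤ), ((I.t : ℕ) : ℤ), (I.k : ℤ)] ++
    (List.finRange I.m).flatMap fun e =>
      [((I.src e : ℕ) : ℤ), ((I.tgt e : ℕ) : ℤ), (I.len e : ℤ), I.wt e]

/-- The initial configuration: the input stands in memory from address `0` on; all other memory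
cells and all registers are `0`. -/
def initial : Ram.State where
  reg := fun _ => 0
  mem := fun a => if 0 ≤ a then I.encode.getD a.toNat 0 else 0

/-- A `k`-tuple of paths as a list of integers: for each path, its number of edges and then its
edges in order. -/
def encodePaths (P : Fin I.k → List (Fin I.m)) : List ℤ :=
  (List.finRange I.k).flatMap fun i =>
    ((P i).length : ℤ) :: (P i).map fun e => ((e : ℕ) : ℤ)

/-- A final configuration solves the instance: either register `0` holds `1` and an optimal
solution stands in memory from the address in register `1` on, or register `0` holds `0` and there
is no `s`-`t` path at all. -/
def SolvedBy (σ : Ram.State) : Prop :=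
  (σ.reg 0 = 1 ∧ ∃ P : Fin I.k → List (Fin I.m),
      I.IsOptimal P ∧ σ.WrittenAt (σ.reg 1) (I.encodePaths P)) ∨
    (σ.reg 0 = 0 ∧ ∀ p, ¬ I.IsPath p)

end DSPInstance

/-!
The diversity of a `k`-tuple of paths in which the edge `e` is used `c e` times is
`∑ e, w e * c e * (k - c e)` (`diversity_eq`). Hence the problem is to find a flow of value `k` from
`s` to `t` that minimises lexicographically the total length and the separable convex function
`∑ e, w e * c e * (c e - k)`, and to split it into `k` paths.

The flow is built by `k` augmentations. Throughout, a vertex potential with values in the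
lexicographically ordered group `ℤ × ℤ` certifies that all arcs of the residual network have
nonnegative reduced cost (`Pot.Feas`). The zero potential serves the zero flow, because lengths are
positive. To find an augmenting path, a set of settled vertices is grown from `s`: the residual arc
of least reduced cost that leads out of the set is determined, the potential of the set is lowered by
this amount, which keeps it feasible (`Pot.Feas.shift`) and gives the arc reduced cost `0`, and the
head of the arc is settled. If no arc leads out of the set, then `t` is not reachable
(`Search.no_path`). Pushing a unit of flow along arcs of reduced cost `0` keeps the potential
feasible, because the cost of an edge is convex in its flow (`Pot.Feas.push`).

A feasible potential proves optimality (`isOptimal_of_feas`). Its first component shows that a walk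
from `s` to `t` is a shortest path exactly if all its edges are tight; this holds for all edges that
carry flow. On tight edges the differences of the second component are supergradients of the concave
functions `w e * c * (k - c)`, and summation by parts bounds the diversity of any other tuple. Since
the first component increases along tight edges, walks along the flow repeat no vertex, and no
circulation is left when `k` of them have been removed (`eq_zero_of_net_eq_zero`).

Each search settles at most `2 |E| + 1` vertices and scans all edges for each of them, so the program
takes `O(k |E|²)` steps, and `log |V| ≥ log 2`. No array is ever cleared: the search number `j + 1`
marks the vertices that are settled in the search after `j` augmentations.

The program is written in a small structured language with expressions, arrays and loops that is
compiled to the machine. `Stmt.wp` computes weakest preconditions of loop-free code, and `WP.loop` is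
the rule for loops; both carry a time bound.
-/

/-! ### A structured language over the random access machine -/

namespace Ram

/-- The program variables. They live in the machine registers below `32`. -/
inductive Var where
  | res | base | m | s | t | k | it | j | e | cnt | found | b1 | b2 | nv | be | fail | go | v
  | x1 | x2 | i | o | q | len
  deriving DecidableEq

/-- The register that holds a variable. -/
def Var.idx : Var → ℕ
  | .res => 0 | .base => 1 | .m => 2 | .s => 3 | .t => 4 | .k => 5 | .it => 6 | .j => 7 | .e => 8
  | .cnt => 9 | .found => 10 | .b1 => 11 | .b2 => 12 | .nv => 13 | .be => 14 | .fail => 15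
  | .go => 16 | .v => 17 | .x1 => 18 | .x2 => 19 | .i => 20 | .o => 21 | .q => 22 | .len => 23

theorem Var.idx_lt (x : Var) : x.idx < 32 := by cases x <;> decide

theorem Var.idx_injective : Function.Injective Var.idx := by
  intro a b h
  cases a <;> cases b <;> first | rfl | (exact absurd h (by decide))

/-- The work arrays, indexed by natural numbers. They are interleaved in the negative addresses. -/
inductive Arr where
  | vis | ord | par | p1 | p2 | c | g
  deriving DecidableEq

/-- The residue class modulo `16` that holds an array. -/
def Arr.idx : Arr → ℤ
  | .vis => 1 | .ord => 2 | .par => 3 | .p1 => 4 | .p2 => 5 | .c => 6 | .g => 7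

theorem Arr.idx_bounds (f : Arr) : 1 ≤ f.idx ∧ f.idx ≤ 7 := by cases f <;> decide

theorem Arr.idx_injective : Function.Injective Arr.idx := by
  intro a b h
  cases a <;> cases b <;> first | rfl | (exact absurd h (by decide))

/-- A view of a machine configuration: the variables, the work arrays, and the cells with
nonnegative addresses, which hold the input and the output. -/
structure View where
  reg : Var → ℤ
  arr : Arr → ℕ → ℤ
  cell : ℕ → ℤ

namespace View

/-- Assignment to a variable. -/
def set (h : View) (x : Var) (z : ℤ) : View := { h with reg := Function.update h.reg x z }

/-- Assignment to an array entry. -/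
def setArr (h : View) (f : Arr) (i : ℕ) (z : ℤ) : View :=
  { h with arr := Function.update h.arr f (Function.update (h.arr f) i z) }

/-- Assignment to a cell. -/
def setCell (h : View) (a : ℕ) (z : ℤ) : View := { h with cell := Function.update h.cell a z }

/-- The `f`-th field of the record of edge `z`, in the input format. -/
def edge (h : View) (f : ℕ) (z : ℤ) : ℤ := h.cell (5 + f + 4 * z).toNat

@[simp] theorem reg_set (h : View) (x y : Var) (z : ℤ) :
    (h.set x z).reg y = if y = x then z else h.reg y := by
  simp [set, Function.update_apply]

@[simp] theorem arr_set (h : View) (x : Var) (z : ℤ) : (h.set x z).arr = h.arr := rfl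

@[simp] theorem cell_set (h : View) (x : Var) (z : ℤ) : (h.set x z).cell = h.cell := rfl

@[simp] theorem edge_set (h : View) (x : Var) (z : ℤ) : (h.set x z).edge = h.edge := rfl

@[simp] theorem reg_setArr (h : View) (f : Arr) (i : ℕ) (z : ℤ) :
    (h.setArr f i z).reg = h.reg := rfl

@[simp] theorem arr_setArr (h : View) (f f' : Arr) (i i' : ℕ) (z : ℤ) :
    (h.setArr f i z).arr f' i' = if f' = f ∧ i' = i then z else h.arr f' i' := by
  by_cases hf : f' = f
  · subst hf; simp [setArr, Function.update_apply]
  · simp [setArr, hf]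

@[simp] theorem cell_setArr (h : View) (f : Arr) (i : ℕ) (z : ℤ) :
    (h.setArr f i z).cell = h.cell := rfl

@[simp] theorem edge_setArr (h : View) (f : Arr) (i : ℕ) (z : ℤ) :
    (h.setArr f i z).edge = h.edge := rfl

@[simp] theorem reg_setCell (h : View) (a : ℕ) (z : ℤ) : (h.setCell a z).reg = h.reg := rfl

@[simp] theorem arr_setCell (h : View) (a : ℕ) (z : ℤ) : (h.setCell a z).arr = h.arr := rfl

@[simp] theorem cell_setCell (h : View) (a a' : ℕ) (z : ℤ) :
    (h.setCell a z).cell a' = if a' = a then z else h.cell a' := by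
  simp [setCell, Function.update_apply]

/-- The configuration `σ` looks like `h`. Registers from `32` on are scratch space and are not
seen. -/
structure Rep (h : View) (σ : State) : Prop where
  reg : ∀ x : Var, σ.reg x.idx = h.reg x
  arr : ∀ (f : Arr) (i : ℕ), σ.mem (-(16 * i + f.idx)) = h.arr f i
  cell : ∀ a : ℕ, σ.mem a = h.cell a

theorem Rep.of_scratch {h : View} {σ τ : State} (hr : h.Rep σ)
    (h1 : ∀ r < 32, τ.reg r = σ.reg r) (h2 : τ.mem = σ.mem) : h.Rep τ :=
  ⟨fun x => by rw [h1 _ x.idx_lt, hr.reg], fun f i => by rw [h2, hr.arr],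
    fun a => by rw [h2, hr.cell]⟩

end View

/-- Integer expressions. `edge f x` reads field `f` of the record of edge `x`. -/
inductive Ex where
  | lit (z : ℤ)
  | var (x : Var)
  | add (a b : Ex)
  | sub (a b : Ex)
  | arr (f : Arr) (i : Ex)
  | cell (a : Ex)
  | edge (f : ℕ) (i : Ex)

namespace Ex

/-- The value of an expression. -/
def eval : Ex → View → ℤ
  | lit z, _ => z
  | var x, h => h.reg x
  | add a b, h => a.eval h + b.eval h
  | sub a b, h => a.eval h - b.eval h
  | arr f i, h => h.arr f (i.eval h).toNat
  | cell a, h => h.cell (a.eval h).toNat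
  | edge f i, h => h.edge f (i.eval h)

/-- All indices that the evaluation uses are nonnegative. -/
def Ok : Ex → View → Prop
  | lit _, _ => True
  | var _, _ => True
  | add a b, h => a.Ok h ∧ b.Ok h
  | sub a b, h => a.Ok h ∧ b.Ok h
  | arr _ i, h => i.Ok h ∧ 0 ≤ i.eval h
  | cell a, h => a.Ok h ∧ 0 ≤ a.eval h
  | edge _ i, h => i.Ok h ∧ 0 ≤ i.eval h

/-- Replaces the content `i` of register `d` by the address of entry `i` of the array `f`. -/
def addr (f : Arr) (d : ℕ) : Prog :=
  .seq (.op (.add d d d)) (.seq (.op (.add d d d)) (.seq (.op (.add d d d))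
    (.seq (.op (.add d d d)) (.seq (.op (.const (d + 2) (-f.idx))) (.op (.sub d (d + 2) d))))))

/-- Code that puts the value of an expression into register `d`. -/
def comp : Ex → ℕ → Prog
  | lit z, d => .op (.const d z)
  | var x, d => .seq (.op (.const d 0)) (.op (.add d x.idx d))
  | add a b, d => .seq (a.comp d) (.seq (b.comp (d + 1)) (.op (.add d d (d + 1))))
  | sub a b, d => .seq (a.comp d) (.seq (b.comp (d + 1)) (.op (.sub d d (d + 1))))
  | arr f i, d => .seq (i.comp d) (.seq (addr f d) (.op (.load d d)))
  | cell a, d => .seq (a.comp d) (.op (.load d d))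
  | edge f i, d => .seq (i.comp d) (.seq (.op (.add d d d)) (.seq (.op (.add d d d))
      (.seq (.op (.const (d + 1) (5 + f))) (.seq (.op (.add d (d + 1) d)) (.op (.load d d))))))

/-- The running time of the code of an expression. -/
def cost : Ex → ℕ
  | lit _ => 1
  | var _ => 2
  | add a b => a.cost + (b.cost + 1)
  | sub a b => a.cost + (b.cost + 1)
  | arr _ i => i.cost + (6 + 1)
  | cell a => a.cost + 1
  | edge _ i => i.cost + 5

theorem exec_addr (f : Arr) (d : ℕ) (σ : State) :
    ∃ τ, Exec (addr f d) σ 6 τ ∧ τ.reg d = -(16 * σ.reg d + f.idx) ∧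
      (∀ r < d + 2, r ≠ d → τ.reg r = σ.reg r) ∧ τ.mem = σ.mem := by
  refine ⟨_, Exec.seq (.op _ _) (Exec.seq (.op _ _) (Exec.seq (.op _ _) (Exec.seq (.op _ _)
    (Exec.seq (.op _ _) (.op _ _))))), ?_, ?_, rfl⟩
  · simp [Op.apply]; ring
  · intro r hr hrd
    have : r ≠ d + 2 := by omega
    simp [Op.apply, hrd, this]

theorem exec_comp (e : Ex) : ∀ (d : ℕ) (h : View) (σ : State), 32 ≤ d → h.Rep σ → e.Ok h →
    ∃ τ, Exec (e.comp d) σ e.cost τ ∧ τ.reg d = e.eval h ∧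
      (∀ r < d, τ.reg r = σ.reg r) ∧ τ.mem = σ.mem := by
  have key : ∀ {d : ℕ} {h : View} {σ τ : State}, 32 ≤ d → h.Rep σ →
      (∀ r < d, τ.reg r = σ.reg r) → τ.mem = σ.mem → h.Rep τ :=
    fun hd hr h1 h2 => hr.of_scratch (fun r hr' => h1 r (by omega)) h2
  induction e with
  | lit z =>
    intro d h σ hd hr _
    refine ⟨_, .op _ _, by simp [Op.apply, eval], ?_, rfl⟩
    intro r hr'; simp [Op.apply, hr'.ne]
  | var x =>
    intro d h σ hd hr _
    have hx := x.idx_lt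
    have hne : x.idx ≠ d := by omega
    refine ⟨_, .seq (.op _ _) (.op _ _), ?_, ?_, rfl⟩
    · simp [Op.apply, eval, hne, hr.reg]
    · intro r hr'; simp [Op.apply, hr'.ne]
  | add a b iha ihb =>
    intro d h σ hd hr hok
    obtain ⟨τ, ha1, ha2, ha3, ha4⟩ := iha d h σ hd hr hok.1
    obtain ⟨ρ, hb1, hb2, hb3, hb4⟩ := ihb (d + 1) h τ (by omega) (key hd hr ha3 ha4) hok.2
    refine ⟨_, .seq ha1 (.seq hb1 (.op _ _)), ?_, ?_, by simp [Op.apply, hb4, ha4]⟩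
    · simp [Op.apply, eval, hb2, hb3, ha2]
    · intro r hr'
      simp [Op.apply, hr'.ne, hb3 r (by omega), ha3 r hr']
  | sub a b iha ihb =>
    intro d h σ hd hr hok
    obtain ⟨τ, ha1, ha2, ha3, ha4⟩ := iha d h σ hd hr hok.1
    obtain ⟨ρ, hb1, hb2, hb3, hb4⟩ := ihb (d + 1) h τ (by omega) (key hd hr ha3 ha4) hok.2
    refine ⟨_, .seq ha1 (.seq hb1 (.op _ _)), ?_, ?_, by simp [Op.apply, hb4, ha4]⟩
    · simp [Op.apply, eval, hb2, hb3, ha2]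
    · intro r hr'
      simp [Op.apply, hr'.ne, hb3 r (by omega), ha3 r hr']
  | arr f i ih =>
    intro d h σ hd hr hok
    obtain ⟨τ, h1, h2, h3, h4⟩ := ih d h σ hd hr hok.1
    obtain ⟨ρ, g1, g2, g3, g4⟩ := exec_addr f d τ
    refine ⟨_, .seq h1 (.seq g1 (.op _ _)), ?_, ?_, by simp [Op.apply, h4, g4]⟩
    · have := hr.arr f (i.eval h).toNat
      rw [Int.toNat_of_nonneg hok.2] at this
      simpa [Op.apply, eval, g2, h2, g4, h4] using this
    · intro r hr'
      simp [Op.apply, hr'.ne, g3 r (by omega) hr'.ne, h3 r hr']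
  | cell a ih =>
    intro d h σ hd hr hok
    obtain ⟨τ, h1, h2, h3, h4⟩ := ih d h σ hd hr hok.1
    refine ⟨_, .seq h1 (.op _ _), ?_, ?_, by simp [Op.apply, h4]⟩
    · have := hr.cell (a.eval h).toNat
      rw [Int.toNat_of_nonneg hok.2] at this
      simpa [Op.apply, eval, h2, h4] using this
    · intro r hr'
      simp [Op.apply, hr'.ne, h3 r hr']
  | edge f i ih =>
    intro d h σ hd hr hok
    obtain ⟨τ, h1, h2, h3, h4⟩ := ih d h σ hd hr hok.1
    refine ⟨_, .seq h1 (.seq (.op _ _) (.seq (.op _ _) (.seq (.op _ _) (.seq (.op _ _)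
      (.op _ _))))), ?_, ?_, by simp [Op.apply, h4]⟩
    · have h0 := hok.2
      have := hr.cell (5 + f + 4 * i.eval h).toNat
      rw [Int.toNat_of_nonneg (by omega)] at this
      simp only [Op.apply, eval, View.edge, ← this, h4]
      simp [h2]
      congr 1; ring
    · intro r hr'
      have : r ≠ d + 1 := by omega
      simp [Op.apply, hr'.ne, h3 r hr', this]

end Ex

/-- Boolean expressions. -/
inductive Bx where
  | lt (a b : Ex)
  | eq (a b : Ex)
  | not (a : Bx)
  | and (a b : Bx)
  | or (a b : Bx)

namespace Bx

/-- The truth of a Boolean expression. -/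
def Holds : Bx → View → Prop
  | lt a b, h => a.eval h < b.eval h
  | eq a b, h => a.eval h = b.eval h
  | not a, h => ¬ a.Holds h
  | and a b, h => a.Holds h ∧ b.Holds h
  | or a b, h => a.Holds h ∨ b.Holds h

/-- All indices that the evaluation uses are nonnegative. -/
def Ok : Bx → View → Prop
  | lt a b, h => a.Ok h ∧ b.Ok h
  | eq a b, h => a.Ok h ∧ b.Ok h
  | not a, h => a.Ok h
  | and a b, h => a.Ok h ∧ b.Ok h
  | or a b, h => a.Ok h ∧ b.Ok h

/-- Code that sets register `d` to `1` if the expression is true, and to `0` otherwise. Both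
operands of a connective are evaluated. -/
def comp : Bx → ℕ → Prog
  | lt a b, d => .seq (a.comp d) (.seq (b.comp (d + 1))
      (.ite (.lt d (d + 1)) (.op (.const d 1)) (.op (.const d 0))))
  | eq a b, d => .seq (a.comp d) (.seq (b.comp (d + 1))
      (.ite (.eq d (d + 1)) (.op (.const d 1)) (.op (.const d 0))))
  | not a, d => .seq (a.comp d) (.seq (.op (.const (d + 1) 1)) (.op (.sub d (d + 1) d)))
  | and a b, d => .seq (a.comp d) (.seq (b.comp (d + 1))
      (.ite (.eq d (d + 1)) (.op (.const (d + 1) 0)) (.op (.const d 0))))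
  | or a b, d => .seq (a.comp d) (.seq (b.comp (d + 1))
      (.ite (.eq d (d + 1)) (.op (.const (d + 1) 0)) (.op (.const d 1))))

/-- The running time of the code of a Boolean expression. -/
def cost : Bx → ℕ
  | lt a b => a.cost + (b.cost + (1 + 1))
  | eq a b => a.cost + (b.cost + (1 + 1))
  | not a => a.cost + (1 + 1)
  | and a b => a.cost + (b.cost + (1 + 1))
  | or a b => a.cost + (b.cost + (1 + 1))

open Classical in
theorem exec_comp (e : Bx) : ∀ (d : ℕ) (h : View) (σ : State), 32 ≤ d → h.Rep σ → e.Ok h →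
    ∃ τ, Exec (e.comp d) σ e.cost τ ∧ τ.reg d = (if e.Holds h then 1 else 0) ∧
      (∀ r < d, τ.reg r = σ.reg r) ∧ τ.mem = σ.mem := by
  have key : ∀ {d : ℕ} {h : View} {σ τ : State}, 32 ≤ d → h.Rep σ →
      (∀ r < d, τ.reg r = σ.reg r) → τ.mem = σ.mem → h.Rep τ :=
    fun hd hr h1 h2 => hr.of_scratch (fun r hr' => h1 r (by omega)) h2
  induction e with
  | lt a b =>
    intro d h σ hd hr hok
    obtain ⟨τ, ha1, ha2, ha3, ha4⟩ := a.exec_comp d h σ hd hr hok.1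
    obtain ⟨ρ, hb1, hb2, hb3, hb4⟩ := b.exec_comp (d + 1) h τ (by omega) (key hd hr ha3 ha4) hok.2
    have hd' : ρ.reg d = a.eval h := by rw [hb3 d (by omega), ha2]
    by_cases hlt : a.eval h < b.eval h
    · refine ⟨_, .seq ha1 (.seq hb1 (.ite_true (by simpa [Test.Holds, hd', hb2]) (.op _ _))),
        ?_, ?_, by simp [Op.apply, hb4, ha4]⟩
      · simp [Op.apply, Holds, hlt]
      · intro r hr'
        simp [Op.apply, hr'.ne, hb3 r (by omega), ha3 r hr']
    · refine ⟨_, .seq ha1 (.seq hb1 (.ite_false (by simpa [Test.Holds, hd', hb2] using hlt)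
        (.op _ _))), ?_, ?_, by simp [Op.apply, hb4, ha4]⟩
      · simp [Op.apply, Holds, hlt]
      · intro r hr'
        simp [Op.apply, hr'.ne, hb3 r (by omega), ha3 r hr']
  | eq a b =>
    intro d h σ hd hr hok
    obtain ⟨τ, ha1, ha2, ha3, ha4⟩ := a.exec_comp d h σ hd hr hok.1
    obtain ⟨ρ, hb1, hb2, hb3, hb4⟩ := b.exec_comp (d + 1) h τ (by omega) (key hd hr ha3 ha4) hok.2
    have hd' : ρ.reg d = a.eval h := by rw [hb3 d (by omega), ha2]
    by_cases hlt : a.eval h = b.eval h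
    · refine ⟨_, .seq ha1 (.seq hb1 (.ite_true (by simpa [Test.Holds, hd', hb2]) (.op _ _))),
        ?_, ?_, by simp [Op.apply, hb4, ha4]⟩
      · simp [Op.apply, Holds, hlt]
      · intro r hr'
        simp [Op.apply, hr'.ne, hb3 r (by omega), ha3 r hr']
    · refine ⟨_, .seq ha1 (.seq hb1 (.ite_false (by simpa [Test.Holds, hd', hb2] using hlt)
        (.op _ _))), ?_, ?_, by simp [Op.apply, hb4, ha4]⟩
      · simp [Op.apply, Holds, hlt]
      · intro r hr'
        simp [Op.apply, hr'.ne, hb3 r (by omega), ha3 r hr']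
  | not a iha =>
    intro d h σ hd hr hok
    obtain ⟨τ, ha1, ha2, ha3, ha4⟩ := iha d h σ hd hr hok
    refine ⟨_, .seq ha1 (.seq (.op _ _) (.op _ _)), ?_, ?_, by simp [Op.apply, ha4]⟩
    · by_cases hh : a.Holds h <;> simp [Op.apply, Holds, ha2, hh]
    · intro r hr'
      have : r ≠ d + 1 := by omega
      simp [Op.apply, hr'.ne, this, ha3 r hr']
  | and a b iha ihb =>
    intro d h σ hd hr hok
    obtain ⟨τ, ha1, ha2, ha3, ha4⟩ := iha d h σ hd hr hok.1
    obtain ⟨ρ, hb1, hb2, hb3, hb4⟩ := ihb (d + 1) h τ (by omega) (key hd hr ha3 ha4) hok.2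
    have hd' : ρ.reg d = if a.Holds h then 1 else 0 := by rw [hb3 d (by omega), ha2]
    by_cases hlt : ρ.reg d = ρ.reg (d + 1)
    · refine ⟨_, .seq ha1 (.seq hb1 (.ite_true hlt (.op _ _))),
        ?_, ?_, by simp [Op.apply, hb4, ha4]⟩
      · rw [hd', hb2] at hlt
        by_cases h1 : a.Holds h <;> by_cases h2 : b.Holds h <;>
          simp_all [Op.apply, Holds]
      · intro r hr'
        have : r ≠ d + 1 := by omega
        simp [Op.apply, this, hb3 r (by omega), ha3 r hr']
    · refine ⟨_, .seq ha1 (.seq hb1 (.ite_false hlt (.op _ _))), ?_, ?_,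
        by simp [Op.apply, hb4, ha4]⟩
      · rw [hd', hb2] at hlt
        by_cases h1 : a.Holds h <;> by_cases h2 : b.Holds h <;>
          simp_all [Op.apply, Holds]
      · intro r hr'
        simp [Op.apply, hr'.ne, hb3 r (by omega), ha3 r hr']
  | or a b iha ihb =>
    intro d h σ hd hr hok
    obtain ⟨τ, ha1, ha2, ha3, ha4⟩ := iha d h σ hd hr hok.1
    obtain ⟨ρ, hb1, hb2, hb3, hb4⟩ := ihb (d + 1) h τ (by omega) (key hd hr ha3 ha4) hok.2
    have hd' : ρ.reg d = if a.Holds h then 1 else 0 := by rw [hb3 d (by omega), ha2]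
    by_cases hlt : ρ.reg d = ρ.reg (d + 1)
    · refine ⟨_, .seq ha1 (.seq hb1 (.ite_true hlt (.op _ _))),
        ?_, ?_, by simp [Op.apply, hb4, ha4]⟩
      · rw [hd', hb2] at hlt
        by_cases h1 : a.Holds h <;> by_cases h2 : b.Holds h <;>
          simp_all [Op.apply, Holds]
      · intro r hr'
        have : r ≠ d + 1 := by omega
        simp [Op.apply, this, hb3 r (by omega), ha3 r hr']
    · refine ⟨_, .seq ha1 (.seq hb1 (.ite_false hlt (.op _ _))), ?_, ?_,
        by simp [Op.apply, hb4, ha4]⟩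
      · rw [hd', hb2] at hlt
        by_cases h1 : a.Holds h <;> by_cases h2 : b.Holds h <;>
          simp_all [Op.apply, Holds]
      · intro r hr'
        simp [Op.apply, hr'.ne, hb3 r (by omega), ha3 r hr']

end Bx

/-- Total correctness with a time bound: started in a configuration that looks like `h`, the
program `p` halts within `T` steps in a configuration that looks like some `h'` with `Q h'`. -/
def WP (p : Prog) (T : ℕ) (h : View) (Q : View → Prop) : Prop :=
  ∀ σ, h.Rep σ → ∃ T' τ h', Exec p σ T' τ ∧ T' ≤ T ∧ View.Rep h' τ ∧ Q h'

theorem WP.mono {p : Prog} {T T' : ℕ} {h : View} {Q Q' : View → Prop} (hp : WP p T h Q)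
    (hT : T ≤ T') (hQ : ∀ h', Q h' → Q' h') : WP p T' h Q' := by
  intro σ hσ
  obtain ⟨T₁, τ, h', h1, h2, h3, h4⟩ := hp σ hσ
  exact ⟨T₁, τ, h', h1, h2.trans hT, h3, hQ _ h4⟩

theorem WP.seq {p q : Prog} {T₁ T₂ : ℕ} {h : View} {Q : View → Prop}
    (hp : WP p T₁ h fun h' => WP q T₂ h' Q) : WP (.seq p q) (T₁ + T₂) h Q := by
  intro σ hσ
  obtain ⟨S₁, τ, h', h1, h2, h3, h4⟩ := hp σ hσ
  obtain ⟨S₂, ρ, h'', g1, g2, g3, g4⟩ := h4 τ h3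
  exact ⟨S₁ + S₂, ρ, h'', .seq h1 g1, by omega, g3, g4⟩

/-- Branching on a Boolean expression. -/
def cond (b : Bx) (p q : Prog) : Prog :=
  .seq (b.comp 32) (.seq (.op (.const 33 1)) (.ite (.eq 32 33) p q))

theorem WP.cond {b : Bx} {p q : Prog} {T : ℕ} {h : View} {Q : View → Prop} (hok : b.Ok h)
    (hp : b.Holds h → WP p T h Q) (hq : ¬ b.Holds h → WP q T h Q) :
    WP (cond b p q) (b.cost + (T + 2)) h Q := by
  intro σ hσ
  obtain ⟨τ, h1, h2, h3, h4⟩ := b.exec_comp 32 h σ le_rfl hσ hok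
  set ρ : State := (Op.const 33 1).apply τ with hρ
  have hρr : h.Rep ρ := by
    refine hσ.of_scratch (fun r hr => ?_) (by simp [hρ, Op.apply, h4])
    have : r ≠ 33 := by omega
    simp [hρ, Op.apply, this, h3 r hr]
  by_cases hb : b.Holds h
  · obtain ⟨S, μ, h', g1, g2, g3, g4⟩ := hp hb ρ hρr
    refine ⟨_, μ, h', .seq h1 (.seq (.op _ _) (.ite_true ?_ g1)), by omega, g3, g4⟩
    simp [Test.Holds, Op.apply, h2, hb]
  · obtain ⟨S, μ, h', g1, g2, g3, g4⟩ := hq hb ρ hρr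
    refine ⟨_, μ, h', .seq h1 (.seq (.op _ _) (.ite_false ?_ g1)), by omega, g3, g4⟩
    simp [Test.Holds, Op.apply, h2, hb]

/-- Repetition while a Boolean expression is true. -/
def loop (b : Bx) (p : Prog) : Prog :=
  .seq (.seq (b.comp 32) (.op (.const 33 1)))
    (.while (.eq 32 33) (.seq p (.seq (b.comp 32) (.op (.const 33 1)))))

/-- The rule for loops. `Inv N` is an invariant that bounds by `N` the number of further
iterations. -/
theorem WP.loop {b : Bx} {p : Prog} {B : ℕ} {Q : View → Prop} (Inv : ℕ → View → Prop)
    (hok : ∀ N h, Inv N h → b.Ok h)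
    (step : ∀ N h, Inv N h → b.Holds h → WP p B h fun h' => ∃ N' < N, Inv N' h')
    (done : ∀ N h, Inv N h → ¬ b.Holds h → Q h) {N : ℕ} {h : View} (h0 : Inv N h) :
    WP (Ram.loop b p) ((N + 1) * (B + b.cost + 2)) h Q := by
  have pre : ∀ {h : View} {σ : State}, h.Rep σ → b.Ok h → ∃ τ,
      Exec (.seq (b.comp 32) (.op (.const 33 1))) σ (b.cost + 1) τ ∧ h.Rep τ ∧
        ((Test.eq 32 33).Holds τ ↔ b.Holds h) := by
    intro h σ hσ hok
    obtain ⟨τ, h1, h2, h3, h4⟩ := b.exec_comp 32 h σ le_rfl hσ hok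
    refine ⟨_, .seq h1 (.op _ _), hσ.of_scratch (fun r hr => ?_) (by simp [Op.apply, h4]), ?_⟩
    · have : r ≠ 33 := by omega
      simp [Op.apply, this, h3 r hr]
    · by_cases hb : b.Holds h <;> simp [Test.Holds, Op.apply, h2, hb]
  have main : ∀ (N : ℕ) (h : View) (σ : State), Inv N h → h.Rep σ →
      ((Test.eq 32 33).Holds σ ↔ b.Holds h) → ∃ T τ h', Exec (.while (.eq 32 33)
        (.seq p (.seq (b.comp 32) (.op (.const 33 1))))) σ T τ ∧
          T ≤ N * (B + b.cost + 2) + 1 ∧ View.Rep h' τ ∧ Q h' := by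
    intro N
    induction N using Nat.strong_induction_on with
    | _ N ih =>
      intro h σ hI hσ hb
      by_cases hh : b.Holds h
      · obtain ⟨T₁, τ, h', g1, g2, g3, N', hN, hI'⟩ := step N h hI hh σ hσ
        obtain ⟨ρ, k1, k2, k3⟩ := pre g3 (hok _ _ hI')
        obtain ⟨T₂, μ, h'', l1, l2, l3, l4⟩ := ih N' hN h' ρ hI' k2 k3
        refine ⟨_, μ, h'', .while_true (hb.2 hh) (.seq g1 k1) l1, ?_, l3, l4⟩
        have : (N' + 1) * (B + b.cost + 2) ≤ N * (B + b.cost + 2) := Nat.mul_le_mul_right _ hN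
        rw [add_mul] at this
        omega
      · exact ⟨1, σ, h, .while_false (fun hc => hh (hb.1 hc)), by omega, hσ, done N h hI hh⟩
  intro σ hσ
  obtain ⟨τ, k1, k2, k3⟩ := pre hσ (hok _ _ h0)
  obtain ⟨T₂, μ, h'', l1, l2, l3, l4⟩ := main N h τ h0 k2 k3
  refine ⟨_, μ, h'', .seq k1 l1, ?_, l3, l4⟩
  rw [add_mul]
  omega

/-- The rule for loops with a counter that runs up to `M`. -/
theorem WP.loop_range {b : Bx} {p : Prog} {B M : ℕ} (Inv : ℕ → View → Prop)
    (hok : ∀ i h, i ≤ M → Inv i h → b.Ok h ∧ (b.Holds h ↔ i < M))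
    (step : ∀ i h, i < M → Inv i h → WP p B h (Inv (i + 1))) {h : View} (h0 : Inv 0 h) :
    WP (Ram.loop b p) ((M + 1) * (B + b.cost + 2)) h (Inv M) := by
  refine WP.loop (fun N h => N ≤ M ∧ Inv (M - N) h) ?_ ?_ ?_ (N := M) ⟨le_rfl, by simpa using h0⟩
  · intro N h hI
    exact (hok _ h (by omega) hI.2).1
  · intro N h hI hb
    have := (hok _ h (by omega) hI.2).2.1 hb
    refine (step _ h this hI.2).mono le_rfl fun h' hh' => ⟨N - 1, by omega, by omega, ?_⟩
    rwa [show M - (N - 1) = M - N + 1 by omega]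
  · intro N h hI hb
    have := mt (hok _ h (by omega) hI.2).2.2 hb
    have h1 := hI.1
    have h2 := hI.2
    rwa [show M - N = M by omega] at h2

/-- Loop-free statements. -/
inductive Stmt where
  | skip
  | set (x : Var) (e : Ex)
  | setArr (f : Arr) (i e : Ex)
  | setCell (a e : Ex)
  | seq (p q : Stmt)
  | ite (b : Bx) (p q : Stmt)

namespace Stmt

/-- The code of a statement. -/
def comp : Stmt → Prog
  | skip => .op (.const 32 0)
  | set x e => .seq (e.comp 32) (.seq (.op (.const 33 0)) (.op (.add x.idx 32 33)))
  | setArr f i e => .seq (i.comp 32) (.seq (e.comp 33) (.seq (.op (.const 34 0))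
      (.seq (.op (.add 35 32 34)) (.seq (Ex.addr f 35) (.op (.store 35 33))))))
  | setCell a e => .seq (a.comp 32) (.seq (e.comp 33) (.op (.store 32 33)))
  | seq p q => .seq p.comp q.comp
  | ite b p q => cond b p.comp q.comp

/-- A bound on the running time of a statement. -/
def cost : Stmt → ℕ
  | skip => 1
  | set _ e => e.cost + 2
  | setArr _ i e => i.cost + (e.cost + 9)
  | setCell a e => a.cost + (e.cost + 1)
  | seq p q => p.cost + q.cost
  | ite b p q => b.cost + (max p.cost q.cost + 2)

/-- The weakest precondition of a statement. -/
def wp : Stmt → View → (View → Prop) → Prop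
  | skip, h, Q => Q h
  | set x e, h, Q => e.Ok h ∧ Q (h.set x (e.eval h))
  | setArr f i e, h, Q =>
      i.Ok h ∧ e.Ok h ∧ 0 ≤ i.eval h ∧ Q (h.setArr f (i.eval h).toNat (e.eval h))
  | setCell a e, h, Q =>
      a.Ok h ∧ e.Ok h ∧ 0 ≤ a.eval h ∧ Q (h.setCell (a.eval h).toNat (e.eval h))
  | seq p q, h, Q => p.wp h fun h' => q.wp h' Q
  | ite b p q, h, Q => b.Ok h ∧ (b.Holds h → p.wp h Q) ∧ (¬ b.Holds h → q.wp h Q)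

theorem sound (p : Stmt) : ∀ (h : View) (Q : View → Prop), p.wp h Q → WP p.comp p.cost h Q := by
  induction p with
  | skip =>
    intro h Q hQ σ hσ
    refine ⟨_, _, h, .op _ _, le_rfl, hσ.of_scratch (fun r hr => ?_) rfl, hQ⟩
    simp [Op.apply, hr.ne]
  | set x e =>
    intro h Q hQ σ hσ
    obtain ⟨τ, h1, h2, h3, h4⟩ := e.exec_comp 32 h σ le_rfl hσ hQ.1
    refine ⟨_, _, _, .seq h1 (.seq (.op _ _) (.op _ _)), by simp [cost], ?_, hQ.2⟩
    refine ⟨fun y => ?_, fun f i => by simpa [Op.apply, h4] using hσ.arr f i,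
      fun a => by simp [Op.apply, h4, hσ.cell]⟩
    by_cases hy : y = x
    · subst hy; simp [Op.apply, h2]
    · have hy' : y.idx ≠ x.idx := fun hc => hy (Var.idx_injective hc)
      have hy3 : y.idx ≠ 33 := by have := y.idx_lt; omega
      simp [Op.apply, hy, hy', hy3, h3 _ y.idx_lt, hσ.reg]
  | setArr f i e =>
    intro h Q hQ σ hσ
    obtain ⟨hi, he, h0, hQ⟩ := hQ
    obtain ⟨τ, h1, h2, h3, h4⟩ := i.exec_comp 32 h σ le_rfl hσ hi
    obtain ⟨ρ, g1, g2, g3, g4⟩ := e.exec_comp 33 h τ (by omega) (hσ.of_scratch h3 h4) he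
    set μ : State := (Op.add 35 32 34).apply ((Op.const 34 0).apply ρ) with hμ
    obtain ⟨ν, k1, k2, k3, k4⟩ := Ex.exec_addr f 35 μ
    have hμ35 : μ.reg 35 = i.eval h := by
      simp [hμ, Op.apply, g3, h2]
    have hμ33 : μ.reg 33 = e.eval h := by
      simp [hμ, Op.apply, g2]
    have hμm : μ.mem = σ.mem := by simp [hμ, Op.apply, g4, h4]
    refine ⟨_, _, _, .seq h1 (.seq g1 (.seq (.op _ _) (.seq (.op _ _) (.seq k1 (.op _ _))))),
      by simp [cost], ?_, hQ⟩
    have e1 : ν.reg 33 = e.eval h := by rw [k3 33 (by omega) (by omega), hμ33]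
    have e2 : ν.reg 35 = -(16 * i.eval h + f.idx) := by rw [k2, hμ35]
    have e3 : ν.mem = σ.mem := by rw [k4, hμm]
    refine ⟨fun y => ?_, fun f' i' => ?_, fun a => ?_⟩
    · have hy := y.idx_lt
      have hy4 : y.idx ≠ 34 := by omega
      have hy5 : y.idx ≠ 35 := by omega
      have : μ.reg y.idx = h.reg y := by
        simp [hμ, Op.apply, hy4, hy5, g3 _ (by omega : y.idx < 33), h3 _ hy, hσ.reg]
      simp [Op.apply, k3 _ (by omega : y.idx < 35 + 2) hy5, this]
    · have b1 := f.idx_bounds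
      have b2 := f'.idx_bounds
      simp only [Op.apply, e1, e2, e3, Function.update_apply, View.arr_setArr]
      by_cases hc : f' = f ∧ i' = (i.eval h).toNat
      · rw [if_pos hc, if_pos]
        rw [hc.1, hc.2, Int.toNat_of_nonneg h0]
      · rw [if_neg hc, if_neg, hσ.arr]
        intro hc'
        apply hc
        have : f'.idx = f.idx := by omega
        exact ⟨Arr.idx_injective this, by omega⟩
    · have b1 := f.idx_bounds
      have : (a : ℤ) ≠ -(16 * i.eval h + f.idx) := by omega
      simp only [Op.apply, e1, e2, e3, Function.update_apply, View.cell_setArr, if_neg this,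
        hσ.cell]
  | setCell a e =>
    intro h Q hQ σ hσ
    obtain ⟨hi, he, h0, hQ⟩ := hQ
    obtain ⟨τ, h1, h2, h3, h4⟩ := a.exec_comp 32 h σ le_rfl hσ hi
    obtain ⟨ρ, g1, g2, g3, g4⟩ := e.exec_comp 33 h τ (by omega) (hσ.of_scratch h3 h4) he
    refine ⟨_, _, _, .seq h1 (.seq g1 (.op _ _)), by simp [cost], ?_, hQ⟩
    have e2 : ρ.reg 32 = a.eval h := by rw [g3 32 (by omega), h2]
    refine ⟨fun y => ?_, fun f' i' => ?_, fun a' => ?_⟩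
    · have hy := y.idx_lt
      simp [Op.apply, g3 _ (by omega : y.idx < 33), h3 _ hy, hσ.reg]
    · have b2 := f'.idx_bounds
      have : -(16 * (i' : ℤ) + f'.idx) ≠ a.eval h := by omega
      simp only [Op.apply, e2, Function.update_apply, View.arr_setCell, if_neg this, g4, h4,
        hσ.arr]
    · simp only [Op.apply, e2, g2, Function.update_apply, View.cell_setCell, g4, h4]
      by_cases hc : a' = (a.eval h).toNat
      · rw [if_pos hc, if_pos (by omega)]
      · rw [if_neg hc, if_neg (by omega), hσ.cell]
  | seq p q ihp ihq =>
    intro h Q hQ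
    exact WP.seq ((ihp h _ hQ).mono le_rfl fun h' hh' => ihq h' Q hh')
  | ite b p q ihp ihq =>
    intro h Q hQ
    exact WP.cond hQ.1 (fun hb => (ihp h Q (hQ.2.1 hb)).mono (le_max_left _ _) fun _ h => h)
      (fun hb => (ihq h Q (hQ.2.2 hb)).mono (le_max_right _ _) fun _ h => h)

end Stmt

end Ram

/-! ### Walks and flows -/

namespace DSPInstance

variable {I : DSPInstance}

/-- The net outflow of `c` at the vertex `u`. -/
def net (c : Fin I.m → ℤ) (u : Fin I.n) : ℤ :=
  ∑ e, ((if I.src e = u then c e else 0) - (if I.tgt e = u then c e else 0))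

/-- The unit of supply at `u` and of demand at `v`. -/
def unit (u v x : Fin I.n) : ℤ := (if u = x then 1 else 0) - (if v = x then 1 else 0)

/-- Summation by parts: the potential difference paid by `c` depends only on its net outflows. -/
theorem sum_mul_sub (c : Fin I.m → ℤ) (p : Fin I.n → ℤ) :
    ∑ e, c e * (p (I.src e) - p (I.tgt e)) = ∑ u, net c u * p u := by
  simp only [net, Finset.sum_mul]
  rw [Finset.sum_comm]
  refine Finset.sum_congr rfl fun e _ => ?_
  simp only [sub_mul, Finset.sum_sub_distrib, ite_mul, zero_mul, Finset.sum_ite_eq,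
    Finset.mem_univ, if_true]
  ring

theorem sum_mul_sub_of_flow {c : Fin I.m → ℤ} {r : ℤ} (hc : ∀ u, net c u = r * unit I.s I.t u)
    (p : Fin I.n → ℤ) : ∑ e, c e * (p (I.src e) - p (I.tgt e)) = r * (p I.s - p I.t) := by
  rw [sum_mul_sub]
  simp only [hc, unit, mul_assoc, ← Finset.mul_sum]
  congr 1
  simp [sub_mul, Finset.sum_sub_distrib]

theorem net_add (c d : Fin I.m → ℤ) (u : Fin I.n) :
    net (fun e => c e + d e) u = net c u + net d u := by
  simp only [net, ← Finset.sum_add_distrib]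
  refine Finset.sum_congr rfl fun e _ => ?_
  split_ifs <;> ring

theorem net_sum {ι : Type*} (S : Finset ι) (c : ι → Fin I.m → ℤ) (u : Fin I.n) :
    net (fun e => ∑ i ∈ S, c i e) u = ∑ i ∈ S, net (c i) u := by
  classical
  induction S using Finset.induction_on with
  | empty => simp [net]
  | insert a S ha ih => simp only [Finset.sum_insert ha, net_add, ih]

theorem net_single (e : Fin I.m) (z : ℤ) (u : Fin I.n) :
    net (fun e' => if e' = e then z else 0) u = z * unit (I.src e) (I.tgt e) u := by
  unfold net unit
  rw [Finset.sum_eq_single e]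
  · simp only [if_true]; split_ifs <;> ring
  · intro b _ hb; simp [hb]
  · simp

/-- The edge multiplicities of a walk form a unit flow between its ends. -/
theorem net_count {p : List (Fin I.m)} : ∀ {u v : Fin I.n}, I.IsWalk u p v → ∀ x,
    net (fun e => (p.count e : ℤ)) x = unit u v x := by
  induction p with
  | nil => intro u v h x; cases h; simp [net, unit]
  | cons e p ih =>
    intro u v h x
    obtain ⟨rfl, h⟩ := h
    have : (fun e' => ((e :: p).count e' : ℤ)) =
        fun e' => (p.count e' : ℤ) + (if e' = e then 1 else 0) := by
      funext e'
      rw [List.count_cons]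
      by_cases he : e' = e
      · subst he; simp
      · simp [he, Ne.symm he]
    rw [this, net_add, ih h, net_single]
    simp only [unit]; ring

theorem IsWalk.append {p q : List (Fin I.m)} : ∀ {u v x : Fin I.n}, I.IsWalk u p v →
    I.IsWalk v q x → I.IsWalk u (p ++ q) x := by
  induction p with
  | nil => intro u v x h h'; cases h; exact h'
  | cons e p ih => intro u v x h h'; exact ⟨h.1, ih h.2 h'⟩

/-- A set of vertices that is closed under outgoing edges contains the end of every walk that
starts in it. -/
theorem IsWalk.mem_of_closed {L : List (Fin I.n)} (hL : ∀ e, I.src e ∈ L → I.tgt e ∈ L)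
    {p : List (Fin I.m)} : ∀ {u v : Fin I.n}, I.IsWalk u p v → u ∈ L → v ∈ L := by
  induction p with
  | nil => intro u v h hu; cases h; exact hu
  | cons e p ih => intro u v h hu; exact ih h.2 (hL e (h.1 ▸ hu))

/-- The edge `e` is tight for the length potential `p`. -/
def Tight (p : Fin I.n → ℤ) (e : Fin I.m) : Prop := p (I.tgt e) = p (I.src e) + I.len e

theorem IsWalk.sub_le_length {p : Fin I.n → ℤ} (hp : ∀ e, p (I.tgt e) ≤ p (I.src e) + I.len e)
    {q : List (Fin I.m)} : ∀ {u v : Fin I.n}, I.IsWalk u q v → p v - p u ≤ I.length q := by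
  induction q with
  | nil => intro u v h; cases h; simp [length]
  | cons e q ih =>
    intro u v h
    obtain ⟨rfl, h⟩ := h
    have h1 := ih h
    have h2 := hp e
    simp only [length, List.map_cons, List.sum_cons, Nat.cast_add] at h1 ⊢
    linarith

theorem IsWalk.length_eq {p : Fin I.n → ℤ} {q : List (Fin I.m)} (hq : ∀ e ∈ q, Tight p e) :
    ∀ {u v : Fin I.n}, I.IsWalk u q v → (I.length q : ℤ) = p v - p u := by
  induction q with
  | nil => intro u v h; cases h; simp [length]
  | cons e q ih =>
    intro u v h
    obtain ⟨rfl, h⟩ := h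
    have h1 := ih (fun e' he' => hq e' (List.mem_cons_of_mem _ he')) h
    have h2 := hq e List.mem_cons_self
    simp only [length, List.map_cons, List.sum_cons, Nat.cast_add, Tight] at h1 h2 ⊢
    linarith

theorem IsWalk.tight_of_length {p : Fin I.n → ℤ}
    (hp : ∀ e, p (I.tgt e) ≤ p (I.src e) + I.len e) {q : List (Fin I.m)} :
    ∀ {u v : Fin I.n}, I.IsWalk u q v → (I.length q : ℤ) ≤ p v - p u → ∀ e ∈ q, Tight p e := by
  induction q with
  | nil => intro u v _ _ e he; simp at he
  | cons e q ih =>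
    intro u v h hl e' he'
    obtain ⟨rfl, h⟩ := h
    have h1 := h.sub_le_length hp
    have h2 := hp e
    simp only [length, List.map_cons, List.sum_cons, Nat.cast_add] at h1 hl
    rcases List.mem_cons.1 he' with rfl | he'
    · unfold Tight; linarith
    · exact ih h (by simp only [length]; linarith) e' he'

theorem IsWalk.lt_of_mem {p : Fin I.n → ℤ} {q : List (Fin I.m)} (hq : ∀ e ∈ q, Tight p e) :
    ∀ {u v : Fin I.n}, I.IsWalk u q v → ∀ x ∈ q.map I.tgt, p u < p x := by
  induction q with
  | nil => intro u v _ x hx; simp at hx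
  | cons e q ih =>
    intro u v h x hx
    obtain ⟨rfl, h⟩ := h
    have h2 := hq e List.mem_cons_self
    have h3 := I.len_pos e
    unfold Tight at h2
    rw [List.map_cons, List.mem_cons] at hx
    rcases hx with rfl | hx
    · omega
    · have := ih (fun e' he' => hq e' (List.mem_cons_of_mem _ he')) h x hx
      omega

/-- The potential increases along a walk of tight edges, which therefore repeats no vertex. -/
theorem IsWalk.nodup {p : Fin I.n → ℤ} {q : List (Fin I.m)} (hq : ∀ e ∈ q, Tight p e) :
    ∀ {u v : Fin I.n}, I.IsWalk u q v → (u :: q.map I.tgt).Nodup := by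
  induction q with
  | nil => intro u v _; simp
  | cons e q ih =>
    intro u v h
    refine List.nodup_cons.2 ⟨fun hu => lt_irrefl _ (h.lt_of_mem hq u hu), ?_⟩
    exact ih (fun e' he' => hq e' (List.mem_cons_of_mem _ he')) h.2

theorem IsPath.nodup {p : List (Fin I.m)} (h : I.IsPath p) : p.Nodup :=
  ((List.nodup_cons.1 h.2).2).of_map

/-! ### Diversity as a separable concave function of a flow -/

theorem sum_lt_eq {k : ℕ} (F : Fin k → Fin k → ℤ) (hs : ∀ i j, F i j = F j i)
    (h0 : ∀ i, F i i = 0) :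
    2 * ∑ i : Fin k, ∑ j ∈ Finset.univ.filter (fun j : Fin k => i < j), F i j =
      ∑ i, ∑ j, F i j := by
  have h1 : ∑ i : Fin k, ∑ j : Fin k, F i j =
      ∑ i : Fin k, ∑ j : Fin k, (if i < j then F i j else 0) +
        ∑ i : Fin k, ∑ j : Fin k, (if j < i then F i j else 0) := by
    rw [← Finset.sum_add_distrib]
    refine Finset.sum_congr rfl fun i _ => ?_
    rw [← Finset.sum_add_distrib]
    refine Finset.sum_congr rfl fun j _ => ?_
    rcases lt_trichotomy i j with h | rfl | h
    · simp [h, h.not_gt]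
    · simp [h0]
    · simp [h, h.not_gt]
  have h2 : ∑ i : Fin k, ∑ j : Fin k, (if j < i then F i j else 0) =
      ∑ i : Fin k, ∑ j : Fin k, (if i < j then F i j else 0) := by
    rw [Finset.sum_comm]
    refine Finset.sum_congr rfl fun i _ => Finset.sum_congr rfl fun j _ => ?_
    rw [hs]
  rw [h1, h2]
  simp only [Finset.sum_filter]
  ring

/-- The number of pairs `i < j` that a `0`-`1` sequence separates. -/
theorem sum_lt_sq {k : ℕ} (b : Fin k → ℤ) (hb : ∀ i, b i * b i = b i) :
    ∑ i : Fin k, ∑ j ∈ Finset.univ.filter (fun j : Fin k => i < j), (b i - b j) ^ 2 =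
      (∑ i, b i) * (k - ∑ i, b i) := by
  have h := sum_lt_eq (fun i j => (b i - b j) ^ 2) (fun i j => by ring) (fun i => by ring)
  have h2 : ∑ i : Fin k, ∑ j : Fin k, (b i - b j) ^ 2 =
      2 * ((∑ i, b i) * (k - ∑ i, b i)) := by
    have : ∀ i j, (b i - b j) ^ 2 = b i + b j - 2 * (b i * b j) := by
      intro i j; linear_combination hb i + hb j
    simp only [this, Finset.sum_sub_distrib, Finset.sum_add_distrib, ← Finset.mul_sum,
      ← Finset.sum_mul, Finset.sum_const, Finset.card_univ, Fintype.card_fin, nsmul_eq_mul]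
    ring
  linarith

/-- The number of paths of a tuple that use the edge `e`, with multiplicity. -/
def load (P : Fin I.k → List (Fin I.m)) (e : Fin I.m) : ℤ := ∑ i, ((P i).count e : ℤ)

theorem diversity_eq (P : Fin I.k → List (Fin I.m)) (hP : ∀ i, (P i).Nodup) :
    I.diversity P = ∑ e, I.wt e * (load P e * (I.k - load P e)) := by
  have hb : ∀ e i, ((P i).count e : ℤ) * (P i).count e = (P i).count e := by
    intro e i
    by_cases he : e ∈ P i
    · rw [List.count_eq_one_of_mem (hP i) he]; rfl
    · rw [List.count_eq_zero_of_not_mem he]; rfl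
  have h1 : ∀ i j, ∑ e ∈ symmDiff (P i).toFinset (P j).toFinset, I.wt e =
      ∑ e, I.wt e * (((P i).count e : ℤ) - (P j).count e) ^ 2 := by
    intro i j
    rw [← Finset.sum_subset (Finset.subset_univ (symmDiff (P i).toFinset (P j).toFinset))]
    · refine Finset.sum_congr rfl fun e he => ?_
      rw [Finset.mem_symmDiff, List.mem_toFinset, List.mem_toFinset] at he
      rcases he with ⟨h1, h2⟩ | ⟨h1, h2⟩ <;>
        simp [List.count_eq_one_of_mem (hP _) h1, List.count_eq_zero_of_not_mem h2]
    · intro e _ he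
      rw [Finset.mem_symmDiff, List.mem_toFinset, List.mem_toFinset] at he
      by_cases h1 : e ∈ P i <;> by_cases h2 : e ∈ P j
      · simp [List.count_eq_one_of_mem (hP _) h1, List.count_eq_one_of_mem (hP _) h2]
      · exact absurd (Or.inl ⟨h1, h2⟩) he
      · exact absurd (Or.inr ⟨h2, h1⟩) he
      · simp [List.count_eq_zero_of_not_mem h1, List.count_eq_zero_of_not_mem h2]
  unfold diversity weightedDiversity
  simp only [h1]
  have h2 : ∀ e, I.wt e * (load P e * (I.k - load P e)) =
      ∑ i : Fin I.k, ∑ j ∈ Finset.univ.filter (fun j : Fin I.k => i < j),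
        I.wt e * (((P i).count e : ℤ) - (P j).count e) ^ 2 := by
    intro e
    rw [load, ← sum_lt_sq _ (hb e)]
    simp only [Finset.mul_sum]
  simp only [h2]
  rw [Finset.sum_comm]
  refine Finset.sum_congr rfl fun i _ => ?_
  rw [Finset.sum_comm]

end DSPInstance

/-! ### Residual arcs, potentials and optimality -/

namespace DSPInstance

variable {I : DSPInstance}

/-- A flow `c`, the weight part `g` of the cost of one more unit on each edge, and the two
components of a lexicographic vertex potential. -/
@[ext] structure Pot (I : DSPInstance) where
  c : Fin I.m → ℤ
  g : Fin I.m → ℤ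
  p1 : Fin I.n → ℤ
  p2 : Fin I.n → ℤ

/-- A residual arc: an edge that is used forwards (`true`) or backwards (`false`). -/
abbrev Arc (I : DSPInstance) := Fin I.m × Bool

/-- The tail of a residual arc. -/
def Arc.tail (a : I.Arc) : Fin I.n := if a.2 then I.src a.1 else I.tgt a.1

/-- The head of a residual arc. -/
def Arc.head (a : I.Arc) : Fin I.n := if a.2 then I.tgt a.1 else I.src a.1

/-- The lexicographic order on pairs. -/
def LexLE (x y x' y' : ℤ) : Prop := x < x' ∨ x = x' ∧ y ≤ y'

namespace Pot

/-- The length component of the reduced cost of a residual arc. -/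
def s1 (P : Pot I) (a : I.Arc) : ℤ :=
  if a.2 then P.p1 (I.src a.1) + I.len a.1 - P.p1 (I.tgt a.1)
  else P.p1 (I.tgt a.1) - I.len a.1 - P.p1 (I.src a.1)

/-- The weight component of the reduced cost of a residual arc. -/
def s2 (P : Pot I) (a : I.Arc) : ℤ :=
  if a.2 then P.p2 (I.src a.1) + P.g a.1 - P.p2 (I.tgt a.1)
  else P.p2 (I.tgt a.1) - (P.g a.1 - (I.wt a.1 + I.wt a.1)) - P.p2 (I.src a.1)

/-- Edges can always be used forwards, and backwards if they carry flow. -/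
def Avail (P : Pot I) (a : I.Arc) : Prop := a.2 = true ∨ 0 < P.c a.1

/-- All residual arcs have lexicographically nonnegative reduced cost. -/
def Feas (P : Pot I) : Prop := ∀ a, P.Avail a → LexLE 0 0 (P.s1 a) (P.s2 a)

/-- The residual arc `a` leads out of the set `L`. -/
def Leaving (P : Pot I) (L : List (Fin I.n)) (a : I.Arc) : Prop :=
  P.Avail a ∧ a.tail ∈ L ∧ a.head ∉ L

/-- Lowers the potential by `(b1, b2)` on the set `L`. -/
def shift (P : Pot I) (L : List (Fin I.n)) (b1 b2 : ℤ) : Pot I :=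
  { P with p1 := fun u => if u ∈ L then P.p1 u - b1 else P.p1 u
           p2 := fun u => if u ∈ L then P.p2 u - b2 else P.p2 u }

/-- Sends one unit of flow along a residual arc. -/
def push (P : Pot I) (a : I.Arc) : Pot I :=
  { P with c := Function.update P.c a.1 (if a.2 then P.c a.1 + 1 else P.c a.1 - 1)
           g := Function.update P.g a.1 (if a.2 then P.g a.1 + (I.wt a.1 + I.wt a.1)
                  else P.g a.1 - (I.wt a.1 + I.wt a.1)) }

theorem s1_shift (P : Pot I) (L : List (Fin I.n)) (b1 b2 : ℤ) (a : I.Arc) :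
    (P.shift L b1 b2).s1 a =
      P.s1 a - (if a.tail ∈ L then b1 else 0) + (if a.head ∈ L then b1 else 0) := by
  obtain ⟨e, d⟩ := a
  cases d <;> simp only [shift, s1, Arc.tail, Arc.head] <;> simp <;> split_ifs <;> ring

theorem s2_shift (P : Pot I) (L : List (Fin I.n)) (b1 b2 : ℤ) (a : I.Arc) :
    (P.shift L b1 b2).s2 a =
      P.s2 a - (if a.tail ∈ L then b2 else 0) + (if a.head ∈ L then b2 else 0) := by
  obtain ⟨e, d⟩ := a
  cases d <;> simp only [shift, s2, Arc.tail, Arc.head] <;> simp <;> split_ifs <;> ring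

/-- Lowering the potential of a set by the least reduced cost of an arc that leads out of it keeps
all reduced costs nonnegative. -/
theorem Feas.shift {P : Pot I} (h : P.Feas) {L : List (Fin I.n)} {b1 b2 : ℤ}
    (h0 : LexLE 0 0 b1 b2) (hb : ∀ a, P.Leaving L a → LexLE b1 b2 (P.s1 a) (P.s2 a)) :
    (P.shift L b1 b2).Feas := by
  intro a ha
  have ha' : P.Avail a := ha
  have h1 := h a ha'
  rw [s1_shift, s2_shift]
  by_cases ht : a.tail ∈ L
  · by_cases hh : a.head ∈ L
    · simp only [ht, hh, if_true]; unfold LexLE at *; omega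
    · have := hb a ⟨ha', ht, hh⟩
      simp only [ht, hh, if_true, if_false]; unfold LexLE at *; omega
  · by_cases hh : a.head ∈ L
    · simp only [ht, hh, if_true, if_false]; unfold LexLE at *; omega
    · simp only [ht, hh, if_false]; unfold LexLE at *; omega

/-- Pushing flow along an arc of reduced cost `0` keeps all reduced costs nonnegative, since the
cost of an edge is convex in its flow. -/
theorem Feas.push (hw : ∀ e, 0 ≤ I.wt e) {P : Pot I} (h : P.Feas) {a : I.Arc} (ha : P.Avail a)
    (h1 : P.s1 a = 0) (h2 : P.s2 a = 0) : (P.push a).Feas := by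
  rintro ⟨e', d'⟩ ha'
  obtain ⟨e, d⟩ := a
  by_cases he : e' = e
  · subst he
    have hw' := hw e'
    have hf := h (e', true) (Or.inl rfl)
    cases d <;> cases d' <;>
      simp [Pot.push, s1, s2, Avail, LexLE] at * <;> omega
  · have := h (e', d') (by simpa [Avail, Pot.push, he] using ha')
    simpa [Pot.push, s1, s2, he] using this

theorem net_push (P : Pot I) (a : I.Arc) (u : Fin I.n) :
    net (P.push a).c u = net P.c u + unit a.tail a.head u := by
  obtain ⟨e, d⟩ := a
  have : (P.push (e, d)).c = fun e' => P.c e' + (if e' = e then (if d then 1 else -1) else 0) := by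
    funext e'
    by_cases he : e' = e
    · subst he; cases d <;> simp [push]; ring
    · simp [push, he]
  rw [this, net_add, net_single]
  cases d <;> simp [Arc.tail, Arc.head, unit]

/-- The flow values are nonnegative and `g` is the marginal cost of the separable function
`∑ e, w e * c e * (c e - k)`. -/
structure Valid (P : Pot I) : Prop where
  nonneg : ∀ e, 0 ≤ P.c e
  marginal : ∀ e, P.g e = I.wt e * (2 * P.c e + 1 - I.k)

theorem Valid.push {P : Pot I} (h : P.Valid) {a : I.Arc} (ha : P.Avail a) : (P.push a).Valid := by
  obtain ⟨e, d⟩ := a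
  refine ⟨fun e' => ?_, fun e' => ?_⟩
  · have := h.nonneg e'
    by_cases he : e' = e
    · subst he
      cases d <;> simp [Pot.push, Avail] at * <;> omega
    · simpa [Pot.push, he] using this
  · have := h.marginal e'
    by_cases he : e' = e
    · subst he
      cases d <;> simp [Pot.push, this] <;> ring
    · simpa [Pot.push, he] using this

theorem Feas.le {P : Pot I} (h : P.Feas) (e : Fin I.m) :
    P.p1 (I.tgt e) ≤ P.p1 (I.src e) + I.len e := by
  have := h (e, true) (Or.inl rfl)
  simp [LexLE, s1] at this
  omega

theorem Feas.tight {P : Pot I} (h : P.Feas) {e : Fin I.m} (he : 0 < P.c e) : Tight P.p1 e := by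
  have h1 := h.le e
  have := h (e, false) (Or.inr he)
  simp [LexLE, s1] at this
  unfold Tight
  omega

/-- On tight edges, the potential difference is a supergradient of the concave objective. -/
theorem Feas.concave {P : Pot I} (h : P.Feas) (hv : P.Valid) (hw : ∀ e, 0 ≤ I.wt e)
    {e : Fin I.m} (he : Tight P.p1 e) {y : ℤ} (hy : 0 ≤ y) :
    I.wt e * (y * (I.k - y)) ≤ I.wt e * (P.c e * (I.k - P.c e)) +
      (y - P.c e) * (P.p2 (I.src e) - P.p2 (I.tgt e)) := by
  have hw' := hw e
  have hm := hv.marginal e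
  have h0 := hv.nonneg e
  rcases le_or_gt (P.c e) y with hxy | hxy
  · have hf := h (e, true) (Or.inl rfl)
    simp only [LexLE, s1, s2, if_true, Tight] at hf he
    have hf' : P.p2 (I.tgt e) - P.p2 (I.src e) ≤ P.g e := by omega
    obtain ⟨d, rfl⟩ : ∃ d : ℕ, y = P.c e + d := ⟨(y - P.c e).toNat, by omega⟩
    have h1 := mul_le_mul_of_nonneg_left hf' (Int.natCast_nonneg d)
    have h2 : 0 ≤ I.wt e * ((d : ℤ) * (d - 1)) := by
      refine mul_nonneg hw' ?_
      rcases Nat.eq_zero_or_pos d with rfl | hd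
      · simp
      · exact mul_nonneg (by omega) (by omega)
    rw [hm] at h1
    nlinarith
  · have hf := h (e, false) (Or.inr (show 0 < P.c e by omega))
    simp only [LexLE, s1, s2, Tight] at hf he
    have hf' : P.g e - (I.wt e + I.wt e) ≤ P.p2 (I.tgt e) - P.p2 (I.src e) := by
      simp at hf; omega
    obtain ⟨d, hd⟩ : ∃ d : ℕ, P.c e = y + d := ⟨(P.c e - y).toNat, by omega⟩
    have h1 := mul_le_mul_of_nonneg_left hf' (Int.natCast_nonneg d)
    have h2 : 0 ≤ I.wt e * ((d : ℤ) * (d - 1)) := by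
      refine mul_nonneg hw' ?_
      exact mul_nonneg (by omega) (by omega)
    rw [hm] at h1
    rw [hd] at h1 ⊢
    nlinarith

end Pot

theorem net_load {Q : Fin I.k → List (Fin I.m)} (hQ : ∀ i, I.IsWalk I.s (Q i) I.t) (u : Fin I.n) :
    net (load Q) u = I.k * unit I.s I.t u := by
  have : load Q = fun e => ∑ i ∈ Finset.univ, ((Q i).count e : ℤ) := rfl
  rw [this, net_sum]
  simp [fun i => net_count (hQ i) u]

/-- A tuple of walks that carries a flow with a feasible potential is an optimal solution: the
first component of the potential certifies that the walks are shortest paths, and the second that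
their diversity is maximal among all tuples of walks whose edges are tight. -/
theorem isOptimal_of_feas (hk : 1 ≤ I.k) (hw : ∀ e, 0 ≤ I.wt e) {P : Pot I} (hf : P.Feas)
    (hv : P.Valid) {Q : Fin I.k → List (Fin I.m)} (hQ : ∀ i, I.IsWalk I.s (Q i) I.t)
    (hc : ∀ e, P.c e = load Q e) : I.IsOptimal Q := by
  have htight : ∀ i, ∀ e ∈ Q i, Tight P.p1 e := by
    intro i e he
    apply hf.tight
    rw [hc, load]
    refine Finset.sum_pos' (fun _ _ => by positivity) ⟨i, Finset.mem_univ _, ?_⟩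
    exact_mod_cast List.count_pos_iff.2 he
  have hlen : ∀ i, (I.length (Q i) : ℤ) = P.p1 I.t - P.p1 I.s :=
    fun i => (hQ i).length_eq (htight i)
  have hpath : ∀ i, I.IsPath (Q i) := fun i => ⟨hQ i, (hQ i).nodup (htight i)⟩
  refine ⟨fun i => ⟨hpath i, fun q hq => ?_⟩, fun R hR => ?_⟩
  · have h1 := hq.1.sub_le_length hf.le
    have h2 := hlen i
    omega
  · have hR1 : ∀ i, I.IsWalk I.s (R i) I.t := fun i => (hR i).1.1
    have hR2 : ∀ i, ∀ e ∈ R i, Tight P.p1 e := by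
      intro i
      refine (hR1 i).tight_of_length hf.le ?_
      have h1 := (hR i).2 _ (hpath ⟨0, hk⟩)
      have h2 := hlen ⟨0, hk⟩
      omega
    rw [diversity_eq R fun i => (hR i).1.nodup, diversity_eq Q fun i => (hpath i).nodup]
    have h1 := sum_mul_sub_of_flow (net_load hR1) P.p2
    have h2 := sum_mul_sub_of_flow (net_load hQ) P.p2
    have h3 : ∑ e, I.wt e * (load R e * (I.k - load R e)) ≤
        ∑ e, (I.wt e * (load Q e * (I.k - load Q e)) +
          (load R e - load Q e) * (P.p2 (I.src e) - P.p2 (I.tgt e))) := by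
      refine Finset.sum_le_sum fun e _ => ?_
      have hnn : 0 ≤ load R e := Finset.sum_nonneg fun _ _ => by positivity
      by_cases he : Tight P.p1 e
      · rw [← hc]
        exact hf.concave hv hw he hnn
      · -- An edge that is not tight is used by neither tuple.
        have h4 : load R e = 0 :=
          Finset.sum_eq_zero fun i _ => by
            rw [List.count_eq_zero_of_not_mem fun h => he (hR2 i e h)]; rfl
        have h5 : load Q e = 0 :=
          Finset.sum_eq_zero fun i _ => by
            rw [List.count_eq_zero_of_not_mem fun h => he (htight i e h)]; rfl
        simp [h4, h5]
    simp only [Finset.sum_add_distrib, sub_mul, Finset.sum_sub_distrib] at h3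
    linarith

end DSPInstance

/-! ### The search for a shortest residual path -/

namespace Ram

instance : Coe Var Ex := ⟨Ex.var⟩

/-- `x := x + 1`. -/
def Stmt.incr (x : Var) : Stmt := .set x (.add x (.lit 1))

/-- Replaces the best arc found so far by the arc `e` with head `v` and reduced cost `(x1, x2)` if
that is cheaper. -/
def relax : Stmt :=
  .ite (.or (.eq Var.found (.lit 0)) (.or (.lt Var.x1 Var.b1)
      (.and (.eq Var.x1 Var.b1) (.lt Var.x2 Var.b2))))
    (.seq (.set .b1 Var.x1) (.seq (.set .b2 Var.x2) (.seq (.set .nv Var.v)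
      (.seq (.set .be Var.e) (.set .found (.lit 1))))))
    .skip

/-- Examines the two residual arcs of the edge `e`. -/
def scanEdge : Stmt :=
  let u : Ex := .edge 0 Var.e
  let v : Ex := .edge 1 Var.e
  let ell : Ex := .edge 2 Var.e
  let w : Ex := .edge 3 Var.e
  .seq
    (.ite (.and (.eq (.arr .vis u) Var.it) (.not (.eq (.arr .vis v) Var.it)))
      (.seq (.set .x1 (.sub (.add (.arr .p1 u) ell) (.arr .p1 v)))
        (.seq (.set .x2 (.sub (.add (.arr .p2 u) (.arr .g Var.e)) (.arr .p2 v)))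
          (.seq (.set .v v) relax)))
      (.ite (.and (.and (.eq (.arr .vis v) Var.it) (.not (.eq (.arr .vis u) Var.it)))
          (.lt (.lit 0) (.arr .c Var.e)))
        (.seq (.set .x1 (.sub (.sub (.arr .p1 v) ell) (.arr .p1 u)))
          (.seq (.set .x2 (.sub (.sub (.arr .p2 v) (.sub (.arr .g Var.e) (.add w w)))
              (.arr .p2 u)))
            (.seq (.set .v u) relax)))
        .skip))
    (.incr .e)

/-- Finds a residual arc of least reduced cost that leads out of the set of settled vertices. -/
def scan : Prog :=
  .seq (Stmt.seq (.set .e (.lit 0)) (.set .found (.lit 0))).comp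
    (loop (.lt Var.e Var.m) scanEdge.comp)

/-- Lowers the potential of the settled vertex number `j`. -/
def shiftVertex : Stmt :=
  .seq (.set .v (.arr .ord Var.j))
    (.seq (.setArr .p1 Var.v (.sub (.arr .p1 Var.v) Var.b1))
      (.seq (.setArr .p2 Var.v (.sub (.arr .p2 Var.v) Var.b2)) (.incr .j)))

/-- Lowers the potential of all settled vertices by `(b1, b2)`. -/
def shiftAll : Prog :=
  .seq (Stmt.set .j (.lit 0)).comp (loop (.lt Var.j Var.cnt) shiftVertex.comp)

/-- Declares the vertex `nv` settled, with parent edge `be`. -/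
def settle : Stmt :=
  .seq (.setArr .vis Var.nv Var.it) (.seq (.setArr .ord Var.cnt Var.nv) (.seq (.incr .cnt)
    (.seq (.setArr .par Var.nv Var.be)
      (.ite (.eq Var.nv Var.t) (.set .go (.lit 1)) .skip))))

/-- One step of the search: settles one more vertex, or fails. -/
def searchStep : Prog :=
  .seq scan (cond (.eq Var.found (.lit 0))
    (Stmt.seq (.set .fail (.lit 1)) (.set .go (.lit 1))).comp
    (.seq shiftAll settle.comp))

/-- Starts the search at `s`. -/
def searchInit : Stmt :=
  .seq (.setArr .vis Var.s Var.it) (.seq (.setArr .ord (.lit 0) Var.s) (.seq (.set .cnt (.lit 1))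
    (.ite (.eq Var.s Var.t) (.set .go (.lit 1)) (.set .go (.lit 0)))))

/-- Searches for a path from `s` to `t` of residual arcs with reduced cost `0`. -/
def search : Prog := .seq searchInit.comp (loop (.eq Var.go (.lit 0)) searchStep)

/-- Sends one unit of flow along the parent arc of the vertex `v` and moves to its tail. -/
def augmentStep : Stmt :=
  let w : Ex := .edge 3 Var.e
  .seq (.set .e (.arr .par Var.v))
    (.ite (.eq (.edge 1 Var.e) Var.v)
      (.seq (.setArr .c Var.e (.add (.arr .c Var.e) (.lit 1)))
        (.seq (.setArr .g Var.e (.add (.arr .g Var.e) (.add w w))) (.set .v (.edge 0 Var.e))))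
      (.seq (.setArr .c Var.e (.sub (.arr .c Var.e) (.lit 1)))
        (.seq (.setArr .g Var.e (.sub (.arr .g Var.e) (.add w w))) (.set .v (.edge 1 Var.e)))))

/-- Sends one unit of flow along the path that has been found. -/
def augment : Prog :=
  .seq (Stmt.set .v Var.t).comp (loop (.not (.eq Var.v Var.s)) augmentStep.comp)

theorem Stmt.wp_mono (p : Stmt) : ∀ {h : View} {Q Q' : View → Prop}, p.wp h Q →
    (∀ h', Q h' → Q' h') → p.wp h Q' := by
  induction p with
  | skip => intro h Q Q' hp hQ; exact hQ _ hp
  | set x e => intro h Q Q' hp hQ; exact ⟨hp.1, hQ _ hp.2⟩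
  | setArr f i e => intro h Q Q' hp hQ; exact ⟨hp.1, hp.2.1, hp.2.2.1, hQ _ hp.2.2.2⟩
  | setCell a e => intro h Q Q' hp hQ; exact ⟨hp.1, hp.2.1, hp.2.2.1, hQ _ hp.2.2.2⟩
  | seq p q ihp ihq => intro h Q Q' hp hQ; exact ihp hp fun h' hh' => ihq hh' hQ
  | ite b p q ihp ihq =>
    intro h Q Q' hp hQ
    exact ⟨hp.1, fun hb => ihp (hp.2.1 hb) hQ, fun hb => ihq (hp.2.2 hb) hQ⟩

/-- `h'` differs from `h` at most in the variables of `l`. -/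
structure Frame (l : List Var) (h h' : View) : Prop where
  reg : ∀ x, x ∉ l → h'.reg x = h.reg x
  arr : h'.arr = h.arr
  cell : h'.cell = h.cell

theorem View.edge_congr {h h' : View} (hc : h'.cell = h.cell) : h'.edge = h.edge := by
  funext f z; simp [View.edge, hc]

end Ram

namespace DSPInstance

open Ram

variable {I : DSPInstance}

/-- The input is in place and the global variables have their values. -/
structure Base (I : DSPInstance) (h : View) : Prop where
  m : h.reg .m = I.m
  s : h.reg .s = (I.s : ℕ)
  t : h.reg .t = (I.t : ℕ)
  k : h.reg .k = I.k
  base : h.reg .base = 5 + 4 * I.m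
  src : ∀ e : Fin I.m, h.edge 0 (e : ℕ) = (I.src e : ℕ)
  tgt : ∀ e : Fin I.m, h.edge 1 (e : ℕ) = (I.tgt e : ℕ)
  len : ∀ e : Fin I.m, h.edge 2 (e : ℕ) = I.len e
  wt : ∀ e : Fin I.m, h.edge 3 (e : ℕ) = I.wt e

/-- The variables with a fixed value throughout the computation. -/
def globals : List Var := [.m, .s, .t, .k, .base]

theorem Base.congr {h h' : View} (hb : Base I h) (hr : ∀ x ∈ globals, h'.reg x = h.reg x)
    (hc : h'.cell = h.cell) : Base I h' := by
  have he := View.edge_congr hc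
  constructor
  · rw [hr _ (by simp [globals]), hb.m]
  · rw [hr _ (by simp [globals]), hb.s]
  · rw [hr _ (by simp [globals]), hb.t]
  · rw [hr _ (by simp [globals]), hb.k]
  · rw [hr _ (by simp [globals]), hb.base]
  · rw [he]; exact hb.src
  · rw [he]; exact hb.tgt
  · rw [he]; exact hb.len
  · rw [he]; exact hb.wt

/-- The flow and the potentials that are stored in memory. -/
def pot (I : DSPInstance) (h : View) : Pot I where
  c e := h.arr .c e
  g e := h.arr .g e
  p1 v := h.arr .p1 v
  p2 v := h.arr .p2 v

/-- The variables describe a best arc among those in `S` that lead out of `L`, if there is one. -/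
def Best (P : Pot I) (L : List (Fin I.n)) (S : I.Arc → Prop) (h : View) : Prop :=
  (h.reg .found = 0 ∧ ∀ a, S a → ¬ P.Leaving L a) ∨
    (h.reg .found = 1 ∧ ∃ a, P.Leaving L a ∧ h.reg .be = (a.1 : ℕ) ∧ h.reg .nv = (a.head : ℕ) ∧
      h.reg .b1 = P.s1 a ∧ h.reg .b2 = P.s2 a ∧
        ∀ a', S a' → P.Leaving L a' → LexLE (P.s1 a) (P.s2 a) (P.s1 a') (P.s2 a'))

theorem relax_wp {P : Pot I} {L : List (Fin I.n)} {S : I.Arc → Prop} {h : View}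
    (hB : Best P L S h) {a : I.Arc} (ha : P.Leaving L a) (he : h.reg .e = (a.1 : ℕ))
    (hv : h.reg .v = (a.head : ℕ)) (h1 : h.reg .x1 = P.s1 a) (h2 : h.reg .x2 = P.s2 a) :
    relax.wp h fun h' => Frame [.b1, .b2, .nv, .be, .found] h h' ∧
      Best P L (fun a' => S a' ∨ a' = a) h' := by
  simp only [relax, Stmt.wp, Bx.Ok, Bx.Holds, Ex.Ok, Ex.eval, View.reg_set]
  refine ⟨by simp, fun hc => ⟨trivial, trivial, trivial, trivial, trivial, ?_, ?_⟩,
    fun hc => ⟨⟨fun _ _ => rfl, rfl, rfl⟩, ?_⟩⟩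
  · refine ⟨fun x hx => ?_, by simp, by simp⟩
    simp only [List.mem_cons, not_or] at hx
    simp [hx]
  · refine Or.inr ⟨by simp, a, ha, by simp [he], by simp [hv], by simp [h1], by simp [h2], ?_⟩
    rintro a' (hS | rfl) hl
    · rcases hB with ⟨-, hB⟩ | ⟨hf, b, hb, -, -, hb1, hb2, hB⟩
      · exact absurd hl (hB a' hS)
      · have := hB a' hS hl
        rw [hf, h1, h2, hb1, hb2] at hc
        unfold LexLE at *
        omega
    · exact Or.inr ⟨rfl, le_rfl⟩
  · rcases hB with ⟨hf, -⟩ | ⟨hf, b, hb, hbe, hnv, hb1, hb2, hB⟩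
    · exact absurd (Or.inl hf) hc
    · refine Or.inr ⟨hf, b, hb, hbe, hnv, hb1, hb2, ?_⟩
      rintro a' (hS | rfl) hl
      · exact hB a' hS hl
      · rw [hf, h1, h2, hb1, hb2] at hc
        unfold LexLE
        omega

theorem Best.congr {P : Pot I} {L : List (Fin I.n)} {S S' : I.Arc → Prop} {h h' : View}
    (hB : Best P L S h) (hr : ∀ x ∈ [Var.found, .be, .nv, .b1, .b2], h'.reg x = h.reg x)
    (hS : ∀ a, P.Leaving L a → (S' a ↔ S a)) : Best P L S' h' := by
  simp only [List.mem_cons, List.not_mem_nil, or_false, forall_eq_or_imp, forall_eq] at hr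
  obtain ⟨r1, r2, r3, r4, r5⟩ := hr
  simp only [Best, r1, r2, r3, r4, r5]
  rcases hB with ⟨h1, h2⟩ | ⟨h1, a, ha, h2, h3, h4, h5, h6⟩
  · exact Or.inl ⟨h1, fun a ha hl => h2 a ((hS a hl).1 ha) hl⟩
  · exact Or.inr ⟨h1, a, ha, h2, h3, h4, h5, fun a' ha' hl => h6 a' ((hS a' hl).1 ha') hl⟩

theorem scanEdge_wp {L : List (Fin I.n)} {h : View} (hb : Base I h)
    (hvis : ∀ x : Fin I.n, h.arr .vis x = h.reg .it ↔ x ∈ L) {e : Fin I.m}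
    (he : h.reg .e = (e : ℕ)) (hB : Best (pot I h) L (fun a => (a.1 : ℕ) < e) h) :
    scanEdge.wp h fun h' => Frame [.b1, .b2, .nv, .be, .found, .x1, .x2, .v, .e] h h' ∧
      h'.reg .e = (e : ℕ) + 1 ∧ Best (pot I h) L (fun a => (a.1 : ℕ) < e + 1) h' := by
  have hlt : ∀ a : I.Arc, (a.1 : ℕ) < e + 1 ↔ (a.1 : ℕ) < e ∨ a = (e, true) ∨ a = (e, false) := by
    rintro ⟨e', d⟩
    cases d <;> simp [Fin.ext_iff] <;> omega
  simp only [scanEdge, Stmt.incr, Stmt.wp, Bx.Ok, Bx.Holds, Ex.Ok, Ex.eval, View.reg_set,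
    View.arr_set, View.edge_set, he, hb.src, hb.tgt, hb.len, hb.wt, Int.toNat_natCast, hvis,
    reduceCtorEq, if_false, if_true, Int.natCast_nonneg, true_and, and_true]
  refine ⟨fun hc => ?_, fun hc => ⟨fun hc' => ?_, fun hc' => ⟨?_, ?_⟩⟩⟩
  · have hl : (pot I h).Leaving L (e, true) := ⟨Or.inl rfl, hc.1, hc.2⟩
    refine Stmt.wp_mono _ (relax_wp (P := pot I h) (S := fun a => (a.1 : ℕ) < e)
      (hB.congr (by simp) fun _ _ => Iff.rfl) hl ?_ ?_ ?_ ?_) ?_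
    · simp [he]
    · simp [Arc.head]
    · simp [Pot.s1, pot]
    · simp [Pot.s2, pot]
    · rintro h' ⟨hf, hB'⟩
      refine ⟨⟨fun x hx => ?_, by simp [hf.arr], by simp [hf.cell]⟩, ?_, ?_⟩
      · simp only [List.mem_cons, not_or] at hx
        simp [hx, hf.reg]
      · simp [hf.reg, he]
      · refine hB'.congr (by simp) fun a ha => ?_
        rw [hlt]
        refine or_congr_right ⟨fun h => ?_, fun h => Or.inl h⟩
        rcases h with h | rfl
        · exact h
        · exact absurd ha.2.1 hc.2
  · have hl : (pot I h).Leaving L (e, false) := ⟨Or.inr hc'.2, hc'.1.1, hc'.1.2⟩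
    refine Stmt.wp_mono _ (relax_wp (P := pot I h) (S := fun a => (a.1 : ℕ) < e)
      (hB.congr (by simp) fun _ _ => Iff.rfl) hl ?_ ?_ ?_ ?_) ?_
    · simp [he]
    · simp [Arc.head]
    · simp [Pot.s1, pot]
    · simp [Pot.s2, pot]
    · rintro h' ⟨hf, hB'⟩
      refine ⟨⟨fun x hx => ?_, by simp [hf.arr], by simp [hf.cell]⟩, ?_, ?_⟩
      · simp only [List.mem_cons, not_or] at hx
        simp [hx, hf.reg]
      · simp [hf.reg, he]
      · refine hB'.congr (by simp) fun a ha => ?_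
        rw [hlt]
        refine or_congr_right ⟨fun h => ?_, fun h => Or.inr h⟩
        rcases h with rfl | h
        · exact absurd ha.2.1 hc'.1.2
        · exact h
  · refine ⟨fun x hx => ?_, by simp, by simp⟩
    simp only [List.mem_cons, not_or] at hx
    simp [hx]
  · refine hB.congr (by simp) fun a ha => ?_
    rw [hlt]
    refine ⟨fun h => ?_, Or.inl⟩
    rcases h with h | rfl | rfl
    · exact h
    · exact absurd ⟨ha.2.1, ha.2.2⟩ hc
    · refine absurd ⟨⟨ha.2.1, ha.2.2⟩, ?_⟩ hc'
      simpa [Pot.Leaving, Pot.Avail, pot] using ha.1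

theorem scanEdge_cost : scanEdge.cost ≤ 400 := by decide

/-- The list of variables that the scan changes. -/
def scanVars : List Var := [.b1, .b2, .nv, .be, .found, .x1, .x2, .v, .e]

theorem scan_wp {L : List (Fin I.n)} {h : View} (hb : Base I h)
    (hvis : ∀ x : Fin I.n, h.arr .vis x = h.reg .it ↔ x ∈ L) :
    WP scan (500 * (I.m + 1)) h fun h' => Frame scanVars h h' ∧
      Best (pot I h) L (fun _ => True) h' := by
  have hloop : ∀ h₁ : View, Frame scanVars h h₁ → h₁.reg .e = 0 → h₁.reg .found = 0 →
      WP (loop (.lt Var.e Var.m) scanEdge.comp) _ h₁ _ := fun h₁ hf he hfd =>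
    WP.loop_range (B := scanEdge.cost) (M := I.m) (fun i h' => Frame scanVars h h' ∧ h'.reg .e = i ∧
        Best (pot I h) L (fun a => (a.1 : ℕ) < i) h')
      (fun i h' hi hI => by
        have := hI.1.reg .m (by simp [scanVars])
        simp [Bx.Ok, Bx.Holds, Ex.Ok, Ex.eval, hI.2.1, this, hb.m])
      (fun i h' hi hI => by
        obtain ⟨hf, he, hB⟩ := hI
        have hp : pot I h' = pot I h := by simp [pot, hf.arr]
        refine (Stmt.sound _ _ _ (scanEdge_wp (L := L) (e := ⟨i, hi⟩) (hb.congr ?_ hf.cell)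
          ?_ he (by rw [hp]; exact hB))).mono le_rfl ?_
        · intro x hx
          apply hf.reg
          simp only [globals, List.mem_cons, List.not_mem_nil, or_false] at hx
          rcases hx with rfl | rfl | rfl | rfl | rfl <;> simp [scanVars]
        · intro x
          rw [hf.arr, hf.reg _ (by simp [scanVars]), hvis]
        · rintro h'' ⟨hf', he', hB'⟩
          rw [hp] at hB'
          exact ⟨⟨fun x hx => (hf'.reg x hx).trans (hf.reg x hx), hf'.arr.trans hf.arr,
            hf'.cell.trans hf.cell⟩, by rw [he']; simp, hB'⟩)
      ⟨hf, by simpa using he, Or.inl ⟨hfd, fun a ha => absurd ha (Nat.not_lt_zero _)⟩⟩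
  have hB : (Bx.lt Var.e Var.m).cost = 6 := rfl
  refine (WP.seq (T₁ := 6) (T₂ := (I.m + 1) * (scanEdge.cost + 6 + 2))
    ((Stmt.sound _ _ (fun h' => Frame scanVars h h' ∧ h'.reg .e = 0 ∧ h'.reg .found = 0) ?_).mono
      le_rfl fun h' hh' => hloop h' hh'.1 hh'.2.1 hh'.2.2)).mono ?_ ?_
  · simp only [Stmt.wp, Ex.Ok, Ex.eval, View.reg_set]
    refine ⟨trivial, trivial, ⟨fun x hx => ?_, by simp, by simp⟩, by simp, by simp⟩
    simp only [scanVars, List.mem_cons, not_or] at hx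
    simp [hx]
  · have := scanEdge_cost
    have : (I.m + 1) * (scanEdge.cost + 6 + 2) ≤ (I.m + 1) * 408 := Nat.mul_le_mul_left _ (by omega)
    omega
  · rintro h' ⟨hf, -, hB⟩
    exact ⟨hf, hB.congr (by simp) fun a _ => by simp⟩

theorem shiftAll_wp {L : List (Fin I.n)} {h : View} (hL : L.Nodup)
    (hord : ∀ i (hi : i < L.length), h.arr .ord i = (L[i] : ℕ)) (hcnt : h.reg .cnt = L.length) :
    WP shiftAll (100 * (L.length + 1)) h fun h' =>
      (∀ x, x ∉ [Var.j, .v] → h'.reg x = h.reg x) ∧ h'.cell = h.cell ∧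
        (∀ f, f ∉ [Arr.p1, .p2] → h'.arr f = h.arr f) ∧
          pot I h' = (pot I h).shift L (h.reg .b1) (h.reg .b2) := by
  set Inv : ℕ → View → Prop := fun i h' => h'.reg .j = i ∧
      (∀ x, x ∉ [Var.j, .v] → h'.reg x = h.reg x) ∧ h'.cell = h.cell ∧
        (∀ f, f ∉ [Arr.p1, .p2] → h'.arr f = h.arr f) ∧
          pot I h' = (pot I h).shift (L.take i) (h.reg .b1) (h.reg .b2) with hInv
  have hloop : ∀ h₁ : View, Inv 0 h₁ →
      WP (loop (.lt Var.j Var.cnt) shiftVertex.comp) _ h₁ _ := fun h₁ h0 =>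
    WP.loop_range (B := shiftVertex.cost) (M := L.length) Inv
      (fun i h' hi hI => by
        have := hI.2.1 .cnt (by simp)
        simp [Bx.Ok, Bx.Holds, Ex.Ok, Ex.eval, hI.1, this, hcnt])
      (fun i h' hi hI => by
        obtain ⟨hj, hr, hc, ha, hp⟩ := hI
        apply Stmt.sound
        have ho : h'.arr .ord i = (L[i] : ℕ) := by rw [ha _ (by simp), hord i hi]
        have hb1 := hr .b1 (by simp)
        have hb2 := hr .b2 (by simp)
        have hnot : L[i] ∉ L.take i := by
          intro hmem
          obtain ⟨j, hj, hji⟩ := List.mem_take_iff_getElem.1 hmem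
          have := (List.Nodup.getElem_inj_iff hL).1 hji
          omega
        simp only [shiftVertex, Stmt.incr, Stmt.wp, Ex.Ok, Ex.eval, View.reg_set, View.arr_set,
          View.reg_setArr, View.arr_setArr, hj, ho, Int.toNat_natCast, reduceCtorEq, if_false,
          if_true, Int.natCast_nonneg, true_and, and_true, hb1, hb2]
        refine ⟨by simp, fun x hx => ?_, by simp [hc], fun f hf => ?_, ?_⟩
        · rw [← hr x hx]
          simp only [List.mem_cons, not_or] at hx
          simp [hx]
        · rw [← ha f hf]
          simp only [List.mem_cons, not_or] at hf
          funext z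
          simp [hf]
        · have e1 := congrArg Pot.p1 hp
          have e2 := congrArg Pot.p2 hp
          have e3 := congrArg Pot.c hp
          have e4 := congrArg Pot.g hp
          have hmem : ∀ u, u ∈ L.take (i + 1) ↔ u = L[i] ∨ u ∈ L.take i := fun u => by
            rw [← List.take_concat_get' L i hi, List.mem_append, List.mem_singleton, or_comm]
          ext u
          · simpa [pot, Pot.shift] using congrFun e3 u
          · simpa [pot, Pot.shift] using congrFun e4 u
          · have := congrFun e1 u
            simp only [pot, Pot.shift] at this
            by_cases hu : u = L[i]
            · subst hu
              rw [if_neg hnot] at this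
              simp [pot, Pot.shift, hmem, this]
            · have hu' : (u : ℕ) ≠ (L[i] : ℕ) := fun hc => hu (Fin.ext hc)
              simp only [pot, Pot.shift, hmem, hu, View.arr_setArr, View.arr_set, hu', this,
                and_false, if_false, false_or, reduceCtorEq, false_and]
          · have := congrFun e2 u
            simp only [pot, Pot.shift] at this
            by_cases hu : u = L[i]
            · subst hu
              rw [if_neg hnot] at this
              simp [pot, Pot.shift, hmem, this]
            · have hu' : (u : ℕ) ≠ (L[i] : ℕ) := fun hc => hu (Fin.ext hc)
              simp only [pot, Pot.shift, hmem, hu, View.arr_setArr, View.arr_set, hu', this,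
                and_false, if_false, false_or, reduceCtorEq, false_and])
      h0
  have hB : (Bx.lt Var.j Var.cnt).cost = 6 := rfl
  have hC : shiftVertex.cost ≤ 80 := by decide
  refine (WP.seq (T₁ := 3) (T₂ := (L.length + 1) * (shiftVertex.cost + 6 + 2))
    ((Stmt.sound _ _ (fun h' => Inv 0 h') ?_).mono
      le_rfl fun h' hh' => hloop h' hh')).mono ?_ ?_
  · simp only [Stmt.wp, Ex.Ok, Ex.eval]
    refine ⟨trivial, by simp, fun x hx => ?_, by simp, by simp, ?_⟩
    · simp only [List.mem_cons, not_or] at hx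
      simp [hx]
    · ext <;> simp [pot, Pot.shift]
  · have : (L.length + 1) * (shiftVertex.cost + 6 + 2) ≤ (L.length + 1) * 88 :=
      Nat.mul_le_mul_left _ (by omega)
    omega
  · rintro h' ⟨-, h1, h2, h3, h4⟩
    exact ⟨h1, h2, h3, by simpa using h4⟩

end DSPInstance

namespace DSPInstance

open Ram

variable {I : DSPInstance}

/-- The parent arc of `x` has reduced cost `0` and comes from a vertex of `L` of lower rank. -/
def IsParent (P : Pot I) (L : List (Fin I.n)) (par : ℕ → ℤ) (ρ : Fin I.n → ℕ) (x : Fin I.n) :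
    Prop :=
  ∃ a : I.Arc, par x = (a.1 : ℕ) ∧ a.head = x ∧ a.tail ∈ L ∧ ρ a.tail < ρ x ∧ P.Avail a ∧
    P.s1 a = 0 ∧ P.s2 a = 0

/-- The invariant of the main loop: the stored potential is feasible for the stored flow. -/
structure Core (I : DSPInstance) (j : ℕ) (h : View) : Prop where
  base : Base I h
  valid : (pot I h).Valid
  feas : (pot I h).Feas
  it : h.reg .it = j + 1
  fail : h.reg .fail = 0
  vis : ∀ x : Fin I.n, h.arr .vis x ≤ j + 1

/-- The state of the search for the path number `j + 1`: the vertices in `L` are settled, and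
following the parent arcs leads from them to `s`, with decreasing rank `ρ`. -/
structure Search (I : DSPInstance) (j : ℕ) (L : List (Fin I.n)) (ρ : Fin I.n → ℕ) (h : View) : Prop
    extends Core I j h where
  flow : ∀ u, net (pot I h).c u = j * unit I.s I.t u
  vis_iff : ∀ x : Fin I.n, h.arr .vis x = j + 1 ↔ x ∈ L
  cnt : h.reg .cnt = L.length
  ord : ∀ i (hi : i < L.length), h.arr .ord i = (L[i] : ℕ)
  nodup : L.Nodup
  s_mem : I.s ∈ L
  rank : ∀ x ∈ L, ρ x < L.length
  parent : ∀ x ∈ L, x ≠ I.s → IsParent (pot I h) L (h.arr .par) ρ x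

/-- Every settled vertex except `s` is an end of an edge. -/
theorem Search.length_le {j : ℕ} {L : List (Fin I.n)} {ρ : Fin I.n → ℕ} {h : View}
    (hs : Search I j L ρ h) : L.length ≤ 2 * I.m + 1 := by
  have hsub : L.toFinset ⊆
      insert I.s (Finset.univ.image I.src ∪ Finset.univ.image I.tgt) := by
    intro x hx
    by_cases hxs : x = I.s
    · simp [hxs]
    · obtain ⟨⟨e, d⟩, -, rfl, -⟩ := hs.parent x (List.mem_toFinset.1 hx) hxs
      cases d <;> simp [Arc.head]
  rw [← List.toFinset_card_of_nodup hs.nodup]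
  refine (Finset.card_le_card hsub).trans ((Finset.card_insert_le _ _).trans ?_)
  have h1 := Finset.card_union_le (Finset.univ.image I.src) (Finset.univ.image I.tgt)
  have h2 := Finset.card_image_le (s := (Finset.univ : Finset (Fin I.m))) (f := I.src)
  have h3 := Finset.card_image_le (s := (Finset.univ : Finset (Fin I.m))) (f := I.tgt)
  simp only [Finset.card_univ, Fintype.card_fin] at h2 h3
  omega

theorem Search.no_path {j : ℕ} {L : List (Fin I.n)} {ρ : Fin I.n → ℕ} {h : View}
    (hs : Search I j L ρ h) (ht : I.t ∉ L) (hl : ∀ a, ¬ (pot I h).Leaving L a) (p : List (Fin I.m)) :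
    ¬ I.IsPath p := fun hp =>
  ht (hp.1.mem_of_closed (fun e he => by
    by_contra hne
    exact hl (e, true) ⟨Or.inl rfl, he, hne⟩) hs.s_mem)

/-- The outcome of a search. -/
def SearchDone (I : DSPInstance) (j : ℕ) (h : View) : Prop :=
  (h.reg .fail = 1 ∧ ∀ p, ¬ I.IsPath p) ∨ ∃ L ρ, Search I j L ρ h ∧ I.t ∈ L

/-- A single step of the search settles a vertex or shows that `t` is out of reach. -/
theorem searchStep_wp {j : ℕ} {L : List (Fin I.n)} {ρ : Fin I.n → ℕ} {h : View}
    (hs : Search I j L ρ h) (ht : I.t ∉ L) (hgo : h.reg .go = 0) :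
    WP searchStep (1000 * (I.m + 1)) h fun h' =>
      (h'.reg .go = 1 ∧ h'.reg .fail = 1 ∧ ∀ p, ¬ I.IsPath p) ∨
        ∃ L' ρ', Search I j L' ρ' h' ∧ L'.length = L.length + 1 ∧
          ((I.t ∈ L' ∧ h'.reg .go = 1) ∨ (I.t ∉ L' ∧ h'.reg .go = 0)) := by
  have hlen := hs.length_le
  have hC : settle.cost ≤ 100 := by decide
  have hB : (Bx.eq Var.found (.lit 0)).cost = 5 := rfl
  refine (WP.seq (T₂ := (Bx.eq Var.found (.lit 0)).cost +
    ((100 * (L.length + 1) + settle.cost) + 2))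
    ((scan_wp (L := L) hs.base fun x => by rw [hs.it]; exact hs.vis_iff x).mono le_rfl
      fun h₁ hh₁ => ?_)).mono (by rw [hB]; omega) fun _ hh => hh
  clear hB
  obtain ⟨hf, hB⟩ := hh₁
  have hp₁ : pot I h₁ = pot I h := by simp [pot, hf.arr]
  refine WP.cond (⟨trivial, trivial⟩) (fun hc => ?_) (fun hc => ?_)
  · refine (Stmt.sound _ _ _ ?_).mono (show 6 ≤ _ by omega) fun _ hh => hh
    simp only [Stmt.wp, Ex.Ok, Ex.eval, View.reg_set]
    refine ⟨trivial, trivial, Or.inl ⟨by simp, by simp, ?_⟩⟩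
    simp only [Bx.Holds, Ex.eval] at hc
    rcases hB with ⟨-, hB⟩ | ⟨hB, -⟩
    · exact hs.no_path ht fun a => hB a trivial
    · omega
  · simp only [Bx.Holds, Ex.eval] at hc
    rcases hB with ⟨hB, -⟩ | ⟨-, a, ha, hbe, hnv, hb1, hb2, hB⟩
    · exact absurd hB hc
    refine WP.seq ((shiftAll_wp (L := L) hs.nodup ?_ ?_).mono le_rfl fun h₂ hh₂ => ?_)
    · rw [hf.arr]; exact hs.ord
    · rw [hf.reg _ (by simp [scanVars]), hs.cnt]
    obtain ⟨r2, c2, a2, p2⟩ := hh₂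
    apply Stmt.sound
    have hreg : ∀ x, x ∉ scanVars ++ [.j] → h₂.reg x = h.reg x := by
      intro x hx
      rw [List.mem_append, not_or] at hx
      rw [r2, hf.reg x hx.1]
      rintro hc
      rcases List.mem_cons.1 hc with rfl | hc
      · simp at hx
      · rw [List.mem_singleton] at hc; subst hc; simp [scanVars] at hx
    have harr : ∀ f, f ∉ [Arr.p1, .p2] → h₂.arr f = h.arr f := fun f hf' => by
      rw [a2 f hf', hf.arr]
    rw [hp₁, hb1, hb2] at p2
    have rnv : h₂.reg .nv = (a.head : ℕ) := by rw [r2 _ (by simp), hnv]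
    have rbe : h₂.reg .be = (a.1 : ℕ) := by rw [r2 _ (by simp), hbe]
    have rit : h₂.reg .it = j + 1 := by rw [hreg _ (by simp [scanVars]), hs.it]
    have rcnt : h₂.reg .cnt = L.length := by rw [hreg _ (by simp [scanVars]), hs.cnt]
    have rt : h₂.reg .t = (I.t : ℕ) := by rw [hreg _ (by simp [scanVars]), hs.base.t]
    have rgo : h₂.reg .go = 0 := by rw [hreg _ (by simp [scanVars]), hgo]
    have rfail : h₂.reg .fail = 0 := by rw [hreg _ (by simp [scanVars]), hs.fail]
    -- The state after settling `a.head` does not depend on the final test.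
    have key : ∀ h₃ : View, (∀ x, x ≠ .go → x ≠ .cnt → h₃.reg x = h₂.reg x) →
        h₃.reg .cnt = L.length + 1 → h₃.cell = h₂.cell →
        h₃.arr = (((h₂.setArr .vis a.head (j + 1)).setArr .ord L.length (a.head : ℕ)).setArr .par
          a.head (a.1 : ℕ)).arr →
        Search I j (L ++ [a.head]) (Function.update ρ a.head L.length) h₃ := by
      intro h₃ k1 k2 k3 k4
      have hP : pot I h₃ = (pot I h).shift L ((pot I h).s1 a) ((pot I h).s2 a) := by
        rw [← p2]; simp [pot, k4]
      have hfin : ∀ x y : Fin I.n, ((x : ℕ) = y) ↔ x = y := fun x y => Fin.ext_iff.symm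
      have hne : ∀ x ∈ L, x ≠ a.head := fun x hx hc => ha.2.2 (hc ▸ hx)
      refine ⟨⟨?_, ?_, ?_, ?_, ?_, ?_⟩, ?_, ?_, ?_, ?_, ?_, ?_, ?_, ?_⟩
      · refine hs.base.congr (fun x hx => ?_) (by rw [k3, c2, hf.cell])
        simp only [globals, List.mem_cons, List.not_mem_nil, or_false] at hx
        rcases hx with rfl | rfl | rfl | rfl | rfl <;>
          rw [k1 _ (by simp) (by simp), hreg _ (by simp [scanVars])]
      · rw [hP]; exact ⟨hs.valid.nonneg, hs.valid.marginal⟩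
      · rw [hP]; exact hs.feas.shift (hs.feas a ha.1) fun a' ha' => hB a' trivial ha'
      · rw [k1 _ (by simp) (by simp), rit]
      · rw [k1 _ (by simp) (by simp), rfail]
      · intro x
        have := hs.vis x
        rw [k4]
        simp only [View.arr_setArr, reduceCtorEq, false_and, if_false, true_and,
          harr .vis (by simp)]
        split_ifs <;> omega
      · rw [hP]; exact hs.flow
      · intro x
        rw [k4]
        simp only [View.arr_setArr, reduceCtorEq, false_and, if_false, true_and,
          harr .vis (by simp), hfin, List.mem_append, List.mem_singleton, ← hs.vis_iff x]
        split_ifs with hx <;> simp [hx]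
      · rw [k2]; simp
      · intro i hi
        rw [k4]
        simp only [View.arr_setArr, reduceCtorEq, false_and, if_false, true_and,
          harr .ord (by simp)]
        rw [List.length_append, List.length_singleton] at hi
        rcases Nat.lt_succ_iff_lt_or_eq.1 hi with hi' | rfl
        · rw [if_neg hi'.ne, hs.ord i hi', List.getElem_append_left hi']
        · simp
      · exact List.nodup_append.2 ⟨hs.nodup, by simp, fun x hx y hy => by
          rw [List.mem_singleton.1 hy]; exact hne x hx⟩
      · exact List.mem_append_left _ hs.s_mem
      · intro x hx
        rw [List.length_append, List.length_singleton]
        rcases List.mem_append.1 hx with hx | hx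
        · rw [Function.update_of_ne (hne x hx)]
          have := hs.rank x hx
          omega
        · rw [List.mem_singleton.1 hx, Function.update_self]
          omega
      · intro x hx hxs
        have hpar : ∀ x : Fin I.n, h₃.arr .par x =
            if x = a.head then ((a.1 : ℕ) : ℤ) else h.arr .par x := by
          intro x
          rw [k4]
          simp [harr .par (by simp), hfin]
        rcases List.mem_append.1 hx with hx | hx
        · obtain ⟨b, q1, q2, q3, q4, q5, q6, q7⟩ := hs.parent x hx hxs
          refine ⟨b, ?_, q2, List.mem_append_left _ q3, ?_, ?_, ?_, ?_⟩
          · rw [hpar, if_neg (hne x hx), q1]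
          · rwa [Function.update_of_ne (hne _ q3), Function.update_of_ne (hne _ hx)]
          · rw [hP]; exact q5
          · rw [hP, Pot.s1_shift, if_pos q3, q2, if_pos hx, q6]; ring
          · rw [hP, Pot.s2_shift, if_pos q3, q2, if_pos hx, q7]; ring
        · rw [List.mem_singleton] at hx
          subst hx
          refine ⟨a, ?_, rfl, List.mem_append_left _ ha.2.1, ?_, ?_, ?_, ?_⟩
          · rw [hpar, if_pos rfl]
          · rw [Function.update_of_ne (hne _ ha.2.1), Function.update_self]
            exact hs.rank _ ha.2.1
          · rw [hP]; exact ha.1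
          · rw [hP, Pot.s1_shift, if_pos ha.2.1, if_neg ha.2.2]; ring
          · rw [hP, Pot.s2_shift, if_pos ha.2.1, if_neg ha.2.2]; ring
    simp only [settle, Stmt.incr, Stmt.wp, Bx.Ok, Bx.Holds, Ex.Ok, Ex.eval, View.reg_set,
      View.reg_setArr, rnv, rbe, rit, rcnt, rt, Int.toNat_natCast, reduceCtorEq,
      if_false, if_true, Int.natCast_nonneg, true_and, and_true, Nat.cast_inj]
    refine ⟨fun hc => Or.inr ⟨_, _, key _ ?_ ?_ rfl rfl, by simp, Or.inl ?_⟩,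
      fun hc => Or.inr ⟨_, _, key _ ?_ ?_ rfl rfl, by simp, Or.inr ⟨?_, by simp [rgo]⟩⟩⟩
    · intro x hx hx'; simp [hx, hx']
    · simp
    · simp [Fin.ext hc]
    · intro x hx hx'; simp [hx']
    · simp
    · rw [List.mem_append, List.mem_singleton, not_or]
      exact ⟨ht, fun h => hc (congrArg Fin.val h.symm)⟩

theorem search_wp {j : ℕ} {h : View} (hc : Core I j h)
    (hflow : ∀ u, net (pot I h).c u = j * unit I.s I.t u)
    (hvis : ∀ x : Fin I.n, h.arr .vis x ≤ j) :
    WP search (3000 * (I.m + 1) ^ 2) h (SearchDone I j) := by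
  set Inv : ℕ → View → Prop := fun N h =>
    (∃ L ρ, Search I j L ρ h ∧ I.t ∉ L ∧ h.reg .go = 0 ∧ L.length + N = 2 * I.m + 2) ∨
      (h.reg .go = 1 ∧ SearchDone I j h) with hInv
  have hloop : ∀ h₁ : View, (∃ N ≤ 2 * I.m + 1, Inv N h₁) →
      WP (loop (.eq Var.go (.lit 0)) searchStep)
        ((2 * I.m + 2) * (1000 * (I.m + 1) + 5 + 2)) h₁ (SearchDone I j) := fun h₁ ⟨N, hN, h0⟩ => by
    refine (WP.loop (B := 1000 * (I.m + 1)) Inv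
      (fun N h' hI => by simp [Bx.Ok, Ex.Ok]) ?_ ?_ h0).mono
        (Nat.mul_le_mul (by omega) le_rfl) fun _ hh => hh
    · intro N h' hI hb
      simp only [Bx.Holds, Ex.eval] at hb
      rcases hI with ⟨L, ρ, hs, ht, hgo, hN⟩ | ⟨hgo, -⟩
      · have := hs.length_le
        refine (searchStep_wp hs ht hgo).mono le_rfl ?_
        rintro h'' (⟨h1, h2, h3⟩ | ⟨L', ρ', hs', hl, ⟨ht', hgo'⟩ | ⟨ht', hgo'⟩⟩)
        · exact ⟨0, by omega, Or.inr ⟨h1, Or.inl ⟨h2, h3⟩⟩⟩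
        · exact ⟨0, by omega, Or.inr ⟨hgo', Or.inr ⟨L', ρ', hs', ht'⟩⟩⟩
        · exact ⟨N - 1, by omega, Or.inl ⟨L', ρ', hs', ht', hgo', by omega⟩⟩
      · omega
    · intro N h' hI hb
      simp only [Bx.Holds, Ex.eval] at hb
      rcases hI with ⟨L, ρ, hs, ht, hgo, hN⟩ | ⟨hgo, hd⟩
      · exact absurd hgo hb
      · exact hd
  have hC : searchInit.cost ≤ 100 := by decide
  refine (WP.seq ((Stmt.sound _ _ (fun h' => ∃ N ≤ 2 * I.m + 1, Inv N h') ?_).mono le_rfl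
    hloop)).mono ?_ fun _ hh => hh
  · have key : ∀ h₃ : View, (∀ x, x ≠ .go → x ≠ .cnt → h₃.reg x = h.reg x) →
        h₃.reg .cnt = 1 → h₃.cell = h.cell →
        h₃.arr = ((h.setArr .vis I.s (j + 1)).setArr .ord 0 (I.s : ℕ)).arr →
        Search I j [I.s] (fun _ => 0) h₃ := by
      intro h₃ k1 k2 k3 k4
      have hP : pot I h₃ = pot I h := by simp [pot, k4]
      have hfin : ∀ x y : Fin I.n, ((x : ℕ) = y) ↔ x = y := fun x y => Fin.ext_iff.symm
      refine ⟨⟨?_, ?_, ?_, ?_, ?_, ?_⟩, ?_, ?_, ?_, ?_, ?_, ?_, ?_, ?_⟩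
      · refine hc.base.congr (fun x hx => ?_) k3
        simp only [globals, List.mem_cons, List.not_mem_nil, or_false] at hx
        rcases hx with rfl | rfl | rfl | rfl | rfl <;> rw [k1 _ (by simp) (by simp)]
      · rw [hP]; exact hc.valid
      · rw [hP]; exact hc.feas
      · rw [k1 _ (by simp) (by simp), hc.it]
      · rw [k1 _ (by simp) (by simp), hc.fail]
      · intro x
        have := hc.vis x
        rw [k4]
        simp only [View.arr_setArr, reduceCtorEq, false_and, if_false, true_and]
        split_ifs <;> omega
      · rw [hP]; exact hflow
      · intro x
        have := hvis x
        rw [k4]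
        simp only [View.arr_setArr, reduceCtorEq, false_and, if_false, true_and, hfin,
          List.mem_singleton]
        split_ifs with hx
        · simp [hx]
        · simp only [hx, iff_false]; omega
      · rw [k2]; simp
      · intro i hi
        rw [k4]
        have : i = 0 := by simpa using hi
        subst this
        simp
      · simp
      · simp
      · simp
      · intro x hx hxs
        exact absurd (List.mem_singleton.1 hx) hxs
    simp only [searchInit, Stmt.wp, Bx.Ok, Bx.Holds, Ex.Ok, Ex.eval, View.reg_set,
      View.reg_setArr, hc.base.s, hc.base.t, hc.it, Int.toNat_natCast, reduceCtorEq,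
      if_false, Int.natCast_nonneg, true_and, Nat.cast_inj, le_refl, Int.toNat_zero]
    refine ⟨fun hst => ⟨0, by omega, Or.inr ⟨by simp, Or.inr ⟨_, _, key _ ?_ ?_ rfl rfl, ?_⟩⟩⟩,
      fun hst => ⟨2 * I.m + 1, le_rfl, Or.inl ⟨_, _, key _ ?_ ?_ rfl rfl, ?_, by simp, ?_⟩⟩⟩
    · intro x hx hx'; simp [hx, hx']
    · simp
    · simp [Fin.ext hst]
    · intro x hx hx'; simp [hx, hx']
    · simp
    · rw [List.mem_singleton]
      exact fun h => hst (congrArg Fin.val h.symm)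
    · simp; omega
  · nlinarith [Nat.zero_le I.m, sq_nonneg I.m]

end DSPInstance

/-! ### Augmentation and the main loop -/

namespace Ram

/-- One search and, if it is successful, the augmentation. -/
def mainStep : Prog :=
  .seq search (.seq (cond (.eq Var.fail (.lit 0)) augment Stmt.skip.comp) (Stmt.incr .it).comp)

/-- Sends `k` units of flow from `s` to `t`, as long as `t` can be reached. -/
def mainLoop : Prog :=
  loop (.and (.eq Var.fail (.lit 0)) (.lt Var.it (.add Var.k (.lit 1)))) mainStep

/-- Reads the parameters of the instance. -/
def readInput : Stmt :=
  .seq (.set .m (.cell (.lit 1))) (.seq (.set .s (.cell (.lit 2))) (.seq (.set .t (.cell (.lit 3)))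
    (.seq (.set .k (.cell (.lit 4)))
      (.seq (.set .base (.add (.lit 5) (.add (.add Var.m Var.m) (.add Var.m Var.m))))
        (.seq (.set .fail (.lit 0)) (.seq (.set .it (.lit 1)) (.set .j (.lit 1))))))))

/-- Subtracts the weight of the edge `e` from its marginal cost. -/
def costEdge : Stmt :=
  .seq (.setArr .g Var.e (.sub (.arr .g Var.e) (.edge 3 Var.e))) (.incr .e)

/-- Subtracts from all marginal costs the weights, `k - 1` times. -/
def costLoop : Prog :=
  loop (.lt Var.j Var.k) (.seq (Stmt.set .e (.lit 0)).comp
    (.seq (loop (.lt Var.e Var.m) costEdge.comp) (Stmt.incr .j).comp))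

end Ram

namespace DSPInstance

open Ram

variable {I : DSPInstance}

/-- The state of the augmentation: flow has been sent back from `t` up to the vertex `x`. -/
structure Augmenting (I : DSPInstance) (j : ℕ) (L : List (Fin I.n)) (ρ : Fin I.n → ℕ)
    (x : Fin I.n) (h : View) : Prop extends Core I j h where
  v : h.reg .v = (x : ℕ)
  mem : x ∈ L
  flow : ∀ u, net (pot I h).c u = j * unit I.s I.t u + unit x I.t u
  parent : ∀ y ∈ L, ρ y ≤ ρ x → y ≠ I.s → IsParent (pot I h) L (h.arr .par) ρ y

/-- Pushing flow along the parent arc of `x` does not affect the parent arcs of the vertices of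
lower rank, because they belong to other edges. -/
theorem IsParent.push {P : Pot I} {L : List (Fin I.n)} {par : ℕ → ℤ} {ρ : Fin I.n → ℕ}
    {a : I.Arc} (ha : ρ a.tail < ρ a.head) {y : Fin I.n} (hy : ρ y ≤ ρ a.tail)
    (hp : IsParent P L par ρ y) : IsParent (P.push a) L par ρ y := by
  obtain ⟨b, q1, rfl, q3, q4, q5, q6, q7⟩ := hp
  have hne : b.1 ≠ a.1 := by
    obtain ⟨e, d⟩ := a
    obtain ⟨e', d'⟩ := b
    rintro rfl
    cases d <;> cases d' <;> simp [Arc.head, Arc.tail] at * <;> omega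
  refine ⟨b, q1, rfl, q3, q4, ?_, ?_, ?_⟩
  · simpa [Pot.Avail, Pot.push, hne] using q5
  · simpa [Pot.s1, Pot.push] using q6
  · simpa [Pot.s2, Pot.push, hne] using q7

theorem augmentStep_wp (hw : ∀ e, 0 ≤ I.wt e) {j : ℕ} {L : List (Fin I.n)} {ρ : Fin I.n → ℕ}
    {x : Fin I.n} {h : View} (hA : Augmenting I j L ρ x h) (hx : x ≠ I.s) :
    augmentStep.wp h fun h' => ∃ y, ρ y < ρ x ∧ Augmenting I j L ρ y h' := by
  obtain ⟨a, q1, rfl, q3, q4, q5, q6, q7⟩ := hA.parent x hA.mem le_rfl hx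
  have key : ∀ h' : View, (∀ z, z ≠ .v → z ≠ .e → h'.reg z = h.reg z) → h'.cell = h.cell →
      (∀ f, f ≠ .c → f ≠ .g → h'.arr f = h.arr f) → pot I h' = (pot I h).push a →
      h'.reg .v = (a.tail : ℕ) → Augmenting I j L ρ a.tail h' := by
    intro h' k1 k2 k3 k4 k5
    refine ⟨⟨?_, ?_, ?_, ?_, ?_, ?_⟩, k5, q3, ?_, ?_⟩
    · refine hA.base.congr (fun x hx => ?_) k2
      simp only [globals, List.mem_cons, List.not_mem_nil, or_false] at hx
      rcases hx with rfl | rfl | rfl | rfl | rfl <;> rw [k1 _ (by simp) (by simp)]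
    · rw [k4]; exact hA.valid.push q5
    · rw [k4]; exact hA.feas.push hw q5 q6 q7
    · rw [k1 _ (by simp) (by simp), hA.it]
    · rw [k1 _ (by simp) (by simp), hA.fail]
    · rw [k3 _ (by simp) (by simp)]; exact hA.vis
    · intro u
      rw [k4, Pot.net_push, hA.flow]
      simp only [unit]; ring
    · intro y hy hρ hys
      rw [k4, k3 _ (by simp) (by simp)]
      exact (hA.parent y hy (by omega) hys).push q4 hρ
  have hfin : ∀ x y : Fin I.m, ((x : ℕ) = y) ↔ x = y := fun x y => Fin.ext_iff.symm
  obtain ⟨e, d⟩ := a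
  simp only [augmentStep, Stmt.wp, Bx.Ok, Bx.Holds, Ex.Ok, Ex.eval, View.reg_set,
    View.arr_set, View.edge_set, View.reg_setArr, View.edge_setArr, hA.v, q1, hA.base.tgt,
    hA.base.src, hA.base.wt, Int.toNat_natCast, reduceCtorEq,
    if_false, if_true, Int.natCast_nonneg, true_and, and_true, Nat.cast_inj]
  cases d
  · have hne : ¬ ((I.tgt e : ℕ) = (I.src e : ℕ)) := by
      intro hc
      have : I.tgt e = I.src e := Fin.ext hc
      simp [Arc.tail, Arc.head, this] at q4
    refine ⟨fun hc => absurd hc hne, fun _ => ⟨_, q4, key _ ?_ ?_ ?_ ?_ ?_⟩⟩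
    · intro z hz hz'; simp [hz, hz']
    · simp
    · intro f hf hf'; funext i; simp [hf, hf']
    · ext <;> simp [pot, Pot.push, Function.update_apply, hfin]
    · simp [Arc.tail]
  · refine ⟨fun _ => ⟨_, q4, key _ ?_ ?_ ?_ ?_ ?_⟩, fun hc => absurd rfl hc⟩
    · intro z hz hz'; simp [hz, hz']
    · simp
    · intro f hf hf'; funext i; simp [hf, hf']
    · ext <;> simp [pot, Pot.push, Function.update_apply, hfin]
    · simp [Arc.tail]

theorem augment_wp (hw : ∀ e, 0 ≤ I.wt e) {j : ℕ} {L : List (Fin I.n)} {ρ : Fin I.n → ℕ}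
    {h : View} (hs : Search I j L ρ h) (ht : I.t ∈ L) :
    WP augment (600 * (I.m + 1)) h fun h' => Core I j h' ∧
      ∀ u, net (pot I h').c u = (j + 1 : ℕ) * unit I.s I.t u := by
  have hC : augmentStep.cost ≤ 200 := by decide
  have hB : (Bx.not (.eq Var.v Var.s)).cost = 8 := rfl
  have h3 : (Stmt.set .v Var.t).cost = 4 := rfl
  have hρ := hs.rank _ ht
  have hlen := hs.length_le
  refine (WP.seq ((Stmt.sound _ _ (Augmenting I j L ρ I.t) ?_).mono le_rfl fun h₁ hh₁ =>
    WP.loop (B := augmentStep.cost) (fun N h' => ∃ x, N = ρ x ∧ Augmenting I j L ρ x h')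
      ?_ ?_ ?_ ⟨_, rfl, hh₁⟩)).mono ?_ fun _ hh => hh
  · simp only [Stmt.wp, Ex.Ok, Ex.eval]
    have hP : pot I (h.set .v (h.reg .t)) = pot I h := rfl
    refine ⟨trivial, ⟨?_, hs.valid, hs.feas, ?_, ?_, hs.vis⟩, ?_, ht, ?_, ?_⟩
    · exact hs.base.congr (by simp [globals]) rfl
    · simp [hs.it]
    · simp [hs.fail]
    · simp [hs.base.t]
    · rw [hP]
      intro u
      rw [hs.flow]; simp [unit]
    · intro y hy _ hys
      exact hs.parent y hy hys
  · intro N h' _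
    simp [Bx.Ok, Ex.Ok]
  · rintro N h' ⟨x, rfl, hA⟩ hb
    simp only [Bx.Holds, Ex.eval, hA.v, hA.base.s] at hb
    refine (Stmt.sound _ _ _ (augmentStep_wp hw hA fun hc => hb (by rw [hc]))).mono le_rfl ?_
    rintro h'' ⟨y, hy, hA'⟩
    exact ⟨ρ y, hy, y, rfl, hA'⟩
  · rintro N h' ⟨x, rfl, hA⟩ hb
    simp only [Bx.Holds, Ex.eval, hA.v, hA.base.s, not_not] at hb
    have hx : x = I.s := Fin.ext (by exact_mod_cast hb)
    refine ⟨hA.toCore, fun u => ?_⟩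
    rw [hA.flow, hx]
    push_cast; ring
  · rw [hB, h3]
    have : (ρ I.t + 1) * (augmentStep.cost + 8 + 2) ≤ (2 * I.m + 2) * 210 :=
      Nat.mul_le_mul (by omega) (by omega)
    omega

/-- The invariant of the main loop after `j` augmentations. -/
structure MainInv (I : DSPInstance) (j : ℕ) (h : View) : Prop extends Core I j h where
  flow : ∀ u, net (pot I h).c u = j * unit I.s I.t u
  vis_le : ∀ x : Fin I.n, h.arr .vis x ≤ j

/-- The outcome of the main loop. -/
def MainDone (I : DSPInstance) (j : ℕ) (h : View) : Prop :=
  (h.reg .fail = 1 ∧ ∀ p, ¬ I.IsPath p) ∨ MainInv I j h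

theorem mainStep_wp (hw : ∀ e, 0 ≤ I.wt e) {j : ℕ} {h : View} (hM : MainInv I j h) :
    WP mainStep (3700 * (I.m + 1) ^ 2) h (MainDone I (j + 1)) := by
  have hB : (Bx.eq Var.fail (.lit 0)).cost = 5 := rfl
  have h3 : (Stmt.incr .it).cost = 6 := rfl
  refine (WP.seq ((search_wp hM.toCore hM.flow hM.vis_le).mono le_rfl fun h₁ hh₁ =>
    WP.seq (T₁ := _ + (600 * (I.m + 1) + 2)) (T₂ := (Stmt.incr .it).cost)
      (WP.cond ?_ (fun hc => ?_) fun hc => ?_))).mono ?_ fun _ hh => hh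
  · simp [Bx.Ok, Ex.Ok]
  · rcases hh₁ with ⟨h1, -⟩ | ⟨L, ρ, hs, ht⟩
    · simp only [Bx.Holds, Ex.eval] at hc
      omega
    refine (augment_wp hw hs ht).mono le_rfl ?_
    rintro h₂ ⟨hC, hf⟩
    refine Stmt.sound _ _ _ ?_
    simp only [Stmt.incr, Stmt.wp, Ex.Ok, Ex.eval]
    refine ⟨⟨trivial, trivial⟩, Or.inr ⟨⟨?_, hC.valid, hC.feas, ?_, ?_, ?_⟩, hf, ?_⟩⟩
    · exact hC.base.congr (by simp [globals]) rfl
    · simp [hC.it]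
    · simp [hC.fail]
    · intro x
      have := hC.vis x
      push_cast
      exact this.trans (by omega)
    · intro x
      have := hC.vis x
      push_cast
      exact this
  · refine (Stmt.sound .skip _ _ ?_).mono (by simp [Stmt.cost]; omega) fun _ hh => hh
    refine Stmt.sound _ _ _ ?_
    simp only [Stmt.incr, Stmt.wp, Ex.Ok, Ex.eval]
    rcases hh₁ with ⟨h1, h2⟩ | ⟨L, ρ, hs, ht⟩
    · exact ⟨⟨trivial, trivial⟩, Or.inl ⟨by simpa using h1, h2⟩⟩
    · exact absurd hs.fail hc
  · rw [hB, h3]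
    nlinarith [Nat.zero_le I.m]

theorem mainLoop_wp (hw : ∀ e, 0 ≤ I.wt e) {h : View} (hM : MainInv I 0 h) :
    WP mainLoop (3800 * (I.k + 1) * (I.m + 1) ^ 2) h (MainDone I I.k) := by
  have hB : (Bx.and (.eq Var.fail (.lit 0)) (.lt Var.it (.add Var.k (.lit 1)))).cost = 15 := rfl
  refine (WP.loop (B := 3700 * (I.m + 1) ^ 2) (N := I.k) (fun N h' =>
    (h'.reg .fail = 1 ∧ ∀ p, ¬ I.IsPath p) ∨ ∃ j, j + N = I.k ∧ MainInv I j h') ?_ ?_ ?_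
      (Or.inr ⟨0, by omega, hM⟩)).mono ?_ fun _ hh => hh
  · intro N h' _
    simp [Bx.Ok, Ex.Ok]
  · rintro N h' (⟨h1, -⟩ | ⟨j, hj, hM'⟩) hb
    · simp only [Bx.Holds, Ex.eval] at hb
      omega
    · simp only [Bx.Holds, Ex.eval, hM'.it, hM'.base.k] at hb
      refine (mainStep_wp hw hM').mono le_rfl ?_
      rintro h'' (hd | hM'')
      · exact ⟨0, by omega, Or.inl hd⟩
      · exact ⟨N - 1, by omega, Or.inr ⟨j + 1, by omega, hM''⟩⟩
  · rintro N h' (hd | ⟨j, hj, hM'⟩) hb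
    · exact Or.inl hd
    · simp only [Bx.Holds, Ex.eval, hM'.it, hM'.base.k, hM'.fail, true_and] at hb
      have : j = I.k := by omega
      subst this
      exact Or.inr hM'
  · rw [hB]
    have : 1 ≤ (I.m + 1) ^ 2 := Nat.one_le_pow _ _ (by omega)
    have := Nat.mul_le_mul_left (I.k + 1) (show 3700 * (I.m + 1) ^ 2 + 15 + 2 ≤
      3800 * (I.m + 1) ^ 2 by omega)
    linarith

/-! ### Reading the input -/

/-- The view of the initial configuration. -/
def initialView (I : DSPInstance) : View where
  reg _ := 0
  arr _ _ := 0
  cell a := I.encode.getD a 0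

theorem initialView_rep : (initialView I).Rep I.initial := by
  refine ⟨fun _ => rfl, fun f i => ?_, fun a => ?_⟩
  · have := f.idx_bounds
    have h : ¬ (0 : ℤ) ≤ -(16 * i + f.idx) := by omega
    simp only [initial, if_neg h, initialView]
  · simp [initial, initialView]

theorem getD_flatMap {α : Type*} (f : α → List ℤ) (hf : ∀ x, (f x).length = 4) :
    ∀ (l : List α) (i r : ℕ) (hi : i < l.length), r < 4 →
      (l.flatMap f).getD (4 * i + r) 0 = (f l[i]).getD r 0 := by
  intro l
  induction l with
  | nil => intro i r hi; simp at hi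
  | cons x l ih =>
    intro i r hi hr
    rw [List.flatMap_cons]
    cases i with
    | zero =>
      rw [List.getD_append _ _ _ _ (by rw [hf]; omega)]
      simp
    | succ i =>
      rw [List.getD_append_right _ _ _ _ (by rw [hf]; omega), hf,
        show 4 * (i + 1) + r - 4 = 4 * i + r by omega, ih i r (by simpa using hi) hr]
      simp

theorem initialView_edge (f : ℕ) (hf : f < 4) (e : Fin I.m) :
    (initialView I).edge f (e : ℕ) =
      [((I.src e : ℕ) : ℤ), ((I.tgt e : ℕ) : ℤ), (I.len e : ℤ), I.wt e].getD f 0 := by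
  have h1 : (5 + (f : ℤ) + 4 * (e : ℕ)).toNat = 5 + (4 * (e : ℕ) + f) := by omega
  simp only [View.edge, initialView, h1, encode]
  rw [List.getD_append_right _ _ _ _ (by simp)]
  have := getD_flatMap (fun e : Fin I.m =>
    [((I.src e : ℕ) : ℤ), ((I.tgt e : ℕ) : ℤ), (I.len e : ℤ), I.wt e]) (fun _ => rfl)
    (List.finRange I.m) e f (by simp) hf
  simpa using this

/-- The state of the initialisation of the marginal costs: `i` rounds are complete, and in the
current round the edges below `z` are done. -/
structure Start (I : DSPInstance) (i z : ℕ) (h : View) : Prop where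
  base : Base I h
  fail : h.reg .fail = 0
  it : h.reg .it = 1
  j : h.reg .j = i + 1
  arr : ∀ f, f ≠ .g → ∀ x, h.arr f x = 0
  g : ∀ e : Fin I.m, h.arr .g e = -((i + if (e : ℕ) < z then 1 else 0) * I.wt e)

theorem readInput_wp : readInput.wp (initialView I) (Start I 0 0) := by
  simp only [readInput, Stmt.wp, Ex.Ok, Ex.eval, View.reg_set, View.cell_set, reduceCtorEq,
    if_false, if_true]
  simp only [true_and, and_true]
  refine ⟨by simp, by simp, by simp, by simp, ⟨?_, ?_, ?_, ?_, ?_, ?_, ?_, ?_, ?_⟩, ?_, ?_, ?_, ?_,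
    ?_⟩
  · simp [initialView, encode]
  · simp [initialView, encode]
  · simp [initialView, encode]
  · simp [initialView, encode]
  · simp [initialView, encode]; ring
  · intro e; simpa using initialView_edge 0 (by omega) e
  · intro e; simpa using initialView_edge 1 (by omega) e
  · intro e; simpa using initialView_edge 2 (by omega) e
  · intro e; simpa using initialView_edge 3 (by omega) e
  · simp
  · simp
  · simp
  · intro f _ x; simp [initialView]
  · intro e; simp [initialView]

theorem costEdge_wp {i z : ℕ} (hz : z < I.m) {h : View} (hS : Start I i z h)
    (he : h.reg .e = z) :
    costEdge.wp h fun h' => Start I i (z + 1) h' ∧ h'.reg .e = (z + 1 : ℕ) := by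
  have hwt : h.edge 3 z = I.wt ⟨z, hz⟩ := hS.base.wt ⟨z, hz⟩
  simp only [costEdge, Stmt.incr, Stmt.wp, Ex.Ok, Ex.eval, View.reg_setArr, he, hwt,
    Int.toNat_natCast, Int.natCast_nonneg, true_and, and_true]
  refine ⟨⟨?_, ?_, ?_, ?_, ?_, ?_⟩, by simp⟩
  · exact hS.base.congr (by simp [globals]) rfl
  · simp [hS.fail]
  · simp [hS.it]
  · simp [hS.j]
  · intro f hf x
    simp [hf, hS.arr f hf x]
  · intro e
    have h1 := hS.g e
    have h2 := hS.g ⟨z, hz⟩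
    simp only [View.arr_set, View.arr_setArr, true_and]
    by_cases hez : (e : ℕ) = z
    · have : e = ⟨z, hz⟩ := Fin.ext hez
      subst this
      simp only [lt_irrefl, if_false] at h2
      simp only [if_true, h2, Nat.lt_succ_self]
      ring
    · rw [if_neg hez, h1]
      have : (e : ℕ) < z + 1 ↔ (e : ℕ) < z := by omega
      simp only [this]

theorem costLoop_wp (hk : 1 ≤ I.k) {h : View} (hS : Start I 0 0 h) :
    WP costLoop (200 * I.k * (I.m + 1)) h (Start I (I.k - 1) 0) := by
  have hC : costEdge.cost ≤ 60 := by decide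
  have hB : (Bx.lt Var.e Var.m).cost = 6 := rfl
  have hB' : (Bx.lt Var.j Var.k).cost = 6 := rfl
  have c1 : (Stmt.set .e (.lit 0)).cost = 3 := rfl
  have c2 : (Stmt.incr .j).cost = 6 := rfl
  refine (WP.loop_range (B := 3 + ((I.m + 1) * (costEdge.cost + 6 + 2) + 6)) (M := I.k - 1)
    (fun i h' => Start I i 0 h') ?_ ?_ hS).mono ?_ fun _ hh => hh
  · intro i h' hi hS'
    simp only [Bx.Ok, Bx.Holds, Ex.Ok, Ex.eval, hS'.j, hS'.base.k, true_and]
    omega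
  · intro i h' hi hS'
    refine WP.seq ((Stmt.sound _ _ (fun h' => Start I i 0 h' ∧ h'.reg .e = 0) ?_).mono c1.le
      fun h₁ hh₁ => ?_)
    · simp only [Stmt.wp, Ex.Ok, Ex.eval, true_and]
      refine ⟨⟨hS'.base.congr (by simp [globals]) rfl, ?_, ?_, ?_, hS'.arr, hS'.g⟩, by simp⟩
      · simp [hS'.fail]
      · simp [hS'.it]
      · simp [hS'.j]
    · refine WP.seq ((WP.loop_range (B := costEdge.cost) (M := I.m)
        (fun z h' => Start I i z h' ∧ h'.reg .e = z) ?_ ?_ ?_).mono (by rw [hB]) fun h₂ hh₂ => ?_)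
      · intro z h₂ hz hh₂
        simp only [Bx.Ok, Bx.Holds, Ex.Ok, Ex.eval, hh₂.2, hh₂.1.base.m, true_and]
        omega
      · intro z h₂ hz hh₂
        exact Stmt.sound _ _ _ (costEdge_wp hz hh₂.1 hh₂.2)
      · simpa using hh₁
      · refine (Stmt.sound _ _ _ ?_).mono c2.le fun _ hh => hh
        simp only [Stmt.incr, Stmt.wp, Ex.Ok, Ex.eval, true_and]
        have hS₂ := hh₂.1
        refine ⟨hS₂.base.congr (by simp [globals]) rfl, ?_, ?_, ?_, hS₂.arr, ?_⟩
        · simp [hS₂.fail]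
        · simp [hS₂.it]
        · simp [hS₂.j]
        · intro e
          have := hS₂.g e
          simp only [e.isLt, if_true] at this
          simpa using this
  · rw [hB', show I.k - 1 + 1 = I.k by omega]
    have h1 : (I.m + 1) * (costEdge.cost + 6 + 2) ≤ (I.m + 1) * 68 :=
      Nat.mul_le_mul_left _ (by omega)
    calc _ ≤ I.k * (200 * (I.m + 1)) := Nat.mul_le_mul_left _ (by omega)
      _ = _ := by ring

/-- The zero flow with the zero potential is feasible, since the lengths are positive. -/
theorem Start.mainInv (hk : 1 ≤ I.k) {h : View} (hS : Start I (I.k - 1) 0 h) : MainInv I 0 h := by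
  have hc : (pot I h).c = fun _ => 0 := funext fun e => hS.arr _ (by simp) _
  have hg : ∀ e, (pot I h).g e = -((I.k - 1) * I.wt e) := by
    intro e
    have := hS.g e
    rw [Nat.cast_sub hk] at this
    simpa [pot] using this
  refine ⟨⟨hS.base, ⟨fun e => by rw [hc], fun e => ?_⟩, ?_, ?_, hS.fail, ?_⟩, ?_, ?_⟩
  · rw [hg, hc]; ring
  · rintro ⟨e, d⟩ ha
    have h1 : ∀ v, (pot I h).p1 v = 0 := fun v => hS.arr _ (by simp) _
    have := I.len_pos e
    cases d
    · simp [Pot.Avail, hc] at ha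
    · left
      simp [Pot.s1, h1, this]
  · simpa using hS.it
  · intro x
    rw [hS.arr _ (by simp)]; omega
  · intro u
    rw [hc]; simp [net]
  · intro x
    rw [hS.arr _ (by simp)]; simp

end DSPInstance

/-! ### Decomposition of the flow into paths -/

namespace Ram

/-- Records the edge `e` if it leaves `v` and carries flow. -/
def pickEdge : Stmt :=
  .seq (.ite (.and (.eq (.edge 0 Var.e) Var.v) (.lt (.lit 0) (.arr .c Var.e)))
    (.set .be Var.e) .skip) (.incr .e)

/-- Finds an edge that leaves `v` and carries flow. -/
def pick : Prog := .seq (Stmt.set .e (.lit 0)).comp (loop (.lt Var.e Var.m) pickEdge.comp)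

/-- Takes a unit of flow from the edge `be`, writes the edge to the output and moves to its
target. -/
def emit : Stmt :=
  .seq (.setArr .c Var.be (.sub (.arr .c Var.be) (.lit 1))) (.seq (.setCell Var.o Var.be)
    (.seq (.incr .o) (.seq (.incr .len) (.set .v (.edge 1 Var.be)))))

/-- Begins a path, with an output cell reserved for its number of edges. -/
def beginPath : Stmt :=
  .seq (.set .v Var.s) (.seq (.set .q Var.o) (.seq (.incr .o) (.set .len (.lit 0))))

/-- Writes the number of edges of a path that is complete. -/
def endPath : Stmt := .seq (.setCell Var.q Var.len) (.incr .i)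

/-- Splits the flow into `k` paths and writes them to the output. -/
def decompose : Prog :=
  .seq (Stmt.seq (.set .o Var.base) (.set .i (.lit 0))).comp (loop (.lt Var.i Var.k)
    (.seq beginPath.comp (.seq (loop (.not (.eq Var.v Var.t)) (.seq pick emit.comp)) endPath.comp)))

/-- The program that solves the problem. -/
def solver : Prog :=
  .seq readInput.comp (.seq costLoop (.seq mainLoop
    (cond (.eq Var.fail (.lit 0)) (.seq decompose (Stmt.set .res (.lit 1)).comp)
      (Stmt.set .res (.lit 0)).comp)))

/-- The list `l` stands in consecutive cells from `a` on. -/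
def View.Written (h : View) (a : ℕ) (l : List ℤ) : Prop :=
  ∀ j (hj : j < l.length), h.cell (a + j) = l[j]

theorem View.Written.append {h : View} {a : ℕ} {l l' : List ℤ} (h1 : h.Written a l)
    (h2 : h.Written (a + l.length) l') : h.Written a (l ++ l') := by
  intro j hj
  rw [List.length_append] at hj
  by_cases hjl : j < l.length
  · rw [List.getElem_append_left hjl]; exact h1 j hjl
  · rw [List.getElem_append_right (by omega), ← h2 (j - l.length) (by omega)]
    congr 1; omega

theorem View.Written.congr {h h' : View} {a : ℕ} {l : List ℤ} (hl : h.Written a l)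
    (hc : ∀ j < l.length, h'.cell (a + j) = h.cell (a + j)) : h'.Written a l :=
  fun j hj => (hc j hj).trans (hl j hj)

end Ram

namespace DSPInstance

open Ram

variable {I : DSPInstance}

theorem Base.setCell {h : View} (hb : Base I h) {a : ℕ} (ha : 5 + 4 * I.m ≤ a) (z : ℤ) :
    Base I (h.setCell a z) := by
  have key : ∀ f < 4, ∀ e : Fin I.m, (h.setCell a z).edge f (e : ℕ) = h.edge f (e : ℕ) := by
    intro f hf e
    have : (5 + (f : ℤ) + 4 * (e : ℕ)).toNat ≠ a := by have := e.isLt; omega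
    simp only [View.edge, View.cell_setCell, if_neg this]
  refine ⟨hb.m, hb.s, hb.t, hb.k, hb.base, fun e => ?_, fun e => ?_, fun e => ?_, fun e => ?_⟩
  · rw [key 0 (by omega), hb.src]
  · rw [key 1 (by omega), hb.tgt]
  · rw [key 2 (by omega), hb.len]
  · rw [key 3 (by omega), hb.wt]

theorem pick_wp {h : View} (hb : Base I h) {x : Fin I.n} (hv : h.reg .v = (x : ℕ))
    (hx : ∃ e, I.src e = x ∧ 0 < h.arr .c (e : Fin I.m)) :
    WP pick (100 * (I.m + 1)) h fun h' => Frame [.e, .be] h h' ∧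
      ∃ e : Fin I.m, h'.reg .be = (e : ℕ) ∧ I.src e = x ∧ 0 < h.arr .c e := by
  have hB : (Bx.lt Var.e Var.m).cost = 6 := rfl
  have hC : pickEdge.cost ≤ 80 := by decide
  have c1 : (Stmt.set .e (.lit 0)).cost = 3 := rfl
  refine (WP.seq ((Stmt.sound _ _ (fun h' => Frame [.e, .be] h h' ∧ h'.reg .e = 0) ?_).mono c1.le
    fun h₁ hh₁ => WP.loop_range (B := pickEdge.cost) (M := I.m) (fun i h' =>
      Frame [.e, .be] h h' ∧ h'.reg .e = i ∧
        ((∃ e : Fin I.m, h'.reg .be = (e : ℕ) ∧ I.src e = x ∧ 0 < h.arr .c e) ∨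
          ∀ e : Fin I.m, (e : ℕ) < i → ¬ (I.src e = x ∧ 0 < h.arr .c e))) ?_ ?_ ?_)).mono ?_ ?_
  · simp only [Stmt.wp, Ex.Ok, Ex.eval, true_and]
    refine ⟨⟨fun y hy => ?_, rfl, rfl⟩, by simp⟩
    simp only [List.mem_cons, not_or] at hy
    simp [hy]
  · rintro i h₂ hi ⟨hf, he, -⟩
    have hm := hf.reg .m (by simp)
    simp only [Bx.Ok, Bx.Holds, Ex.Ok, Ex.eval, he, hm, hb.m, true_and]
    omega
  · rintro i h₂ hi ⟨hf, he, hI⟩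
    apply Stmt.sound
    have hsrc : h₂.edge 0 (i : ℕ) = (I.src ⟨i, hi⟩ : ℕ) := by
      rw [View.edge_congr hf.cell]; exact hb.src ⟨i, hi⟩
    have hv₂ : h₂.reg .v = (x : ℕ) := by rw [hf.reg _ (by simp), hv]
    simp only [pickEdge, Stmt.incr, Stmt.wp, Bx.Ok, Bx.Holds, Ex.Ok, Ex.eval, View.reg_set, he,
      hsrc, hv₂, Int.toNat_natCast, reduceCtorEq, if_false, if_true, Int.natCast_nonneg, true_and,
      and_true, hf.arr, Nat.cast_inj]
    refine ⟨fun hc => ⟨⟨fun y hy => ?_, hf.arr, hf.cell⟩, by simp,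
      Or.inl ⟨⟨i, hi⟩, rfl, Fin.ext hc.1, hc.2⟩⟩,
      fun hc => ⟨⟨fun y hy => ?_, hf.arr, hf.cell⟩, by simp, ?_⟩⟩
    · rw [← hf.reg y hy]
      simp only [List.mem_cons, not_or] at hy
      simp [hy]
    · rw [← hf.reg y hy]
      simp only [List.mem_cons, not_or] at hy
      simp [hy]
    · rcases hI with hI | hI
      · exact Or.inl hI
      · refine Or.inr fun e hei => ?_
        rcases Nat.lt_succ_iff_lt_or_eq.1 hei with hei | hei
        · exact hI e hei
        · have : e = ⟨i, hi⟩ := Fin.ext hei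
          subst this
          exact fun h' => hc ⟨congrArg Fin.val h'.1, h'.2⟩
  · exact ⟨hh₁.1, by simpa using hh₁.2, Or.inr fun e he => absurd he (Nat.not_lt_zero _)⟩
  · have : (I.m + 1) * (pickEdge.cost + 6 + 2) ≤ (I.m + 1) * 88 := Nat.mul_le_mul_left _ (by omega)
    rw [hB]
    omega
  · rintro h' ⟨hf, -, hI⟩
    refine ⟨hf, ?_⟩
    rcases hI with hI | hI
    · exact hI
    · obtain ⟨e, he⟩ := hx
      exact absurd he (hI e e.isLt)

/-- The encoding of one path. -/
def encodePath (p : List (Fin I.m)) : List ℤ :=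
  (p.length : ℤ) :: p.map fun e : Fin I.m => ((e : ℕ) : ℤ)

/-- The state of the decomposition of the flow `c₀` when the paths `Ps` have been written and the
walk `p` from `s` to `x` has been removed from the flow, too. -/
structure Emitting (I : DSPInstance) (c₀ : Fin I.m → ℤ) (Ps : List (List (Fin I.m)))
    (p : List (Fin I.m)) (x : Fin I.n) (h : View) : Prop where
  base : Base I h
  nonneg : ∀ e : Fin I.m, 0 ≤ h.arr .c e
  total : ∀ e : Fin I.m,
    h.arr .c e + (Ps.map fun q => (q.count e : ℤ)).sum + (p.count e : ℤ) = c₀ e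
  flow : ∀ u, net (fun e : Fin I.m => h.arr .c e) u =
    unit x I.t u + (I.k - Ps.length - 1) * unit I.s I.t u
  i : h.reg .i = Ps.length
  walks : ∀ q ∈ Ps, I.IsWalk I.s q I.t
  walk : I.IsWalk I.s p x
  written : h.Written (5 + 4 * I.m) (Ps.flatMap encodePath)

/-- The output variables while a path is being written. -/
structure EmittingVars (I : DSPInstance) (Ps : List (List (Fin I.m))) (p : List (Fin I.m))
    (x : Fin I.n) (h : View) : Prop where
  v : h.reg .v = (x : ℕ)
  len : h.reg .len = p.length
  q : h.reg .q = (5 + 4 * I.m + (Ps.flatMap encodePath).length : ℕ)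
  o : h.reg .o = (5 + 4 * I.m + (Ps.flatMap encodePath).length + 1 + p.length : ℕ)
  path : h.Written (5 + 4 * I.m + (Ps.flatMap encodePath).length + 1)
    (p.map fun e : Fin I.m => ((e : ℕ) : ℤ))

theorem sum_count_nonneg (Ps : List (List (Fin I.m))) (e : Fin I.m) :
    0 ≤ (Ps.map fun q => (q.count e : ℤ)).sum :=
  List.sum_nonneg fun z hz => by
    obtain ⟨q, -, rfl⟩ := List.mem_map.1 hz
    positivity

theorem Emitting.length_le {c₀ : Fin I.m → ℤ} {p1 : Fin I.n → ℤ}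
    (ht : ∀ e, 0 < c₀ e → Tight p1 e) {Ps : List (List (Fin I.m))} {p : List (Fin I.m)}
    {x : Fin I.n} {h : View} (hE : Emitting I c₀ Ps p x h) : p.length ≤ I.m := by
  have hn : p.Nodup := by
    refine ((List.nodup_cons.1 (hE.walk.nodup fun e he => ht e ?_)).2).of_map
    have h1 := hE.total e
    have h2 := hE.nonneg e
    have h3 := sum_count_nonneg Ps e
    have h4 := List.count_pos_iff.2 he
    omega
  simpa using hn.length_le_card

/-- By flow conservation, the walk can be continued until it reaches `t`. -/
theorem Emitting.exists_edge {c₀ : Fin I.m → ℤ} {Ps : List (List (Fin I.m))} {p : List (Fin I.m)}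
    {x : Fin I.n} {h : View} (hE : Emitting I c₀ Ps p x h) (hk : Ps.length < I.k) (hx : x ≠ I.t) :
    ∃ e, I.src e = x ∧ 0 < h.arr .c (e : Fin I.m) := by
  by_contra hne
  push Not at hne
  have h1 := hE.flow x
  have h2 : net (fun e : Fin I.m => h.arr .c e) x ≤ 0 := by
    refine Finset.sum_nonpos fun e _ => ?_
    have h3 := hE.nonneg e
    have h4 := hne e
    beta_reduce
    split_ifs with ha hb hb
    · omega
    · have := h4 ha; omega
    · omega
    · omega
  have h3 : unit x I.t x = 1 := by simp [unit, hx.symm]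
  have h4 : 0 ≤ unit I.s I.t x := by simp only [unit, hx.symm, if_false]; split_ifs <;> simp
  have h5 : 0 ≤ ((I.k : ℤ) - Ps.length - 1) * unit I.s I.t x := mul_nonneg (by omega) h4
  omega

theorem emit_wp {c₀ : Fin I.m → ℤ} {Ps : List (List (Fin I.m))} {p : List (Fin I.m)}
    {x : Fin I.n} {h : View} (hE : Emitting I c₀ Ps p x h) (hV : EmittingVars I Ps p x h)
    {e : Fin I.m} (hbe : h.reg .be = (e : ℕ)) (hsrc : I.src e = x) (hpos : 0 < h.arr .c e) :
    emit.wp h fun h' => Emitting I c₀ Ps (p ++ [e]) (I.tgt e) h' ∧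
      EmittingVars I Ps (p ++ [e]) (I.tgt e) h' := by
  have hfin : ∀ x y : Fin I.m, ((x : ℕ) = y) ↔ x = y := fun x y => Fin.ext_iff.symm
  set a := 5 + 4 * I.m + (Ps.flatMap encodePath).length with ha
  have ho : h.reg .o = (a + 1 + p.length : ℕ) := hV.o
  have hbase := hE.base.setCell (a := a + 1 + p.length) (by omega) (e : ℕ)
  have htgt : (h.setCell (a + 1 + p.length) (e : ℕ)).edge 1 (e : ℕ) = (I.tgt e : ℕ) := hbase.tgt e
  have htgt' : ((h.setArr .c e (h.arr .c e - 1)).setCell (a + 1 + p.length) (e : ℕ)).edge 1 (e : ℕ) =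
      (I.tgt e : ℕ) := htgt
  simp only [emit, Stmt.incr, Stmt.wp, Ex.Ok, Ex.eval, View.reg_set, View.reg_setArr,
    View.reg_setCell, View.edge_set, hbe, ho, hV.len, Int.toNat_natCast,
    reduceCtorEq, if_false, Int.natCast_nonneg, true_and, htgt']
  refine ⟨⟨?_, ?_, ?_, ?_, ?_, ?_, ?_, ?_⟩, ⟨?_, ?_, ?_, ?_, ?_⟩⟩
  · refine hbase.congr (fun y hy => ?_) rfl
    simp only [globals, List.mem_cons, List.not_mem_nil, or_false] at hy
    rcases hy with rfl | rfl | rfl | rfl | rfl <;> simp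
  · intro e'
    have := hE.nonneg e'
    simp only [View.arr_set, View.arr_setCell, View.arr_setArr, true_and]
    split_ifs <;> omega
  · intro e'
    have := hE.total e'
    simp only [View.arr_set, View.arr_setCell, View.arr_setArr, true_and, hfin, List.count_append,
      List.count_singleton]
    by_cases he : e' = e
    · subst he; simp; omega
    · simp [he, Ne.symm he]; omega
  · intro u
    have h1 := hE.flow u
    have : (fun e' : Fin I.m => h.arr .c e' + (if e' = e then -1 else 0)) =
        fun e' : Fin I.m => if (e' : ℕ) = e then h.arr .c e - 1 else h.arr .c e' := by
      funext e'
      by_cases he : e' = e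
      · subst he; simp; ring
      · simp [he, hfin]
    simp only [View.arr_set, View.arr_setCell, View.arr_setArr, true_and]
    rw [← this, net_add, h1, net_single, hsrc]
    simp only [unit]; ring
  · simp [hE.i]
  · exact hE.walks
  · exact hE.walk.append ⟨hsrc, rfl⟩
  · refine hE.written.congr fun j hj => ?_
    have : 5 + 4 * I.m + j ≠ a + 1 + p.length := by omega
    simp [this]
  · simp
  · simp
  · simp [hV.q]
  · rw [← ha]; simp; ring
  · rw [← ha, List.map_append]
    have hpath : h.Written (a + 1) (p.map fun e : Fin I.m => ((e : ℕ) : ℤ)) := hV.path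
    refine View.Written.append (hpath.congr fun j hj => ?_) fun j hj => ?_
    · rw [List.length_map] at hj
      simp [hj.ne]
    · have : j = 0 := by simpa using hj
      subst this
      simp

/-- The state of the decomposition between two paths. -/
structure Emitted (I : DSPInstance) (c₀ : Fin I.m → ℤ) (Ps : List (List (Fin I.m))) (h : View) :
    Prop extends Emitting I c₀ Ps [] I.s h where
  o : h.reg .o = (5 + 4 * I.m + (Ps.flatMap encodePath).length : ℕ)

theorem beginPath_wp {c₀ : Fin I.m → ℤ} {Ps : List (List (Fin I.m))} {h : View}
    (hE : Emitted I c₀ Ps h) :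
    beginPath.wp h fun h' => Emitting I c₀ Ps [] I.s h' ∧ EmittingVars I Ps [] I.s h' := by
  simp only [beginPath, Stmt.incr, Stmt.wp, Ex.Ok, Ex.eval, View.reg_set, hE.base.s, hE.o,
    reduceCtorEq, if_false, true_and]
  refine ⟨⟨?_, hE.nonneg, hE.total, hE.flow, ?_, hE.walks, rfl, hE.written⟩, ?_, ?_, ?_, ?_, ?_⟩
  · refine hE.base.congr (fun y hy => ?_) rfl
    simp only [globals, List.mem_cons, List.not_mem_nil, or_false] at hy
    rcases hy with rfl | rfl | rfl | rfl | rfl <;> simp [hE.base.s]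
  · simp [hE.i]
  · simp
  · simp
  · simp
  · simp
  · intro j hj; simp at hj

theorem endPath_wp {c₀ : Fin I.m → ℤ} {Ps : List (List (Fin I.m))} {p : List (Fin I.m)}
    {h : View} (hE : Emitting I c₀ Ps p I.t h) (hV : EmittingVars I Ps p I.t h) :
    endPath.wp h fun h' => Emitted I c₀ (Ps ++ [p]) h' := by
  set a := 5 + 4 * I.m + (Ps.flatMap encodePath).length with ha
  have hq : h.reg .q = (a : ℕ) := hV.q
  have hbase := hE.base.setCell (a := a) (by omega) p.length
  simp only [endPath, Stmt.incr, Stmt.wp, Ex.Ok, Ex.eval, hq, hV.len, View.reg_setCell,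
    Int.toNat_natCast, Int.natCast_nonneg, true_and, hE.i]
  refine ⟨⟨?_, hE.nonneg, ?_, ?_, ?_, ?_, rfl, ?_⟩, ?_⟩
  · exact hbase.congr (by simp [globals]) rfl
  · intro e
    have := hE.total e
    simpa [add_assoc] using this
  · intro u
    have h1 := hE.flow u
    simp only [View.arr_set, View.arr_setCell]
    rw [h1]
    simp [unit]; ring
  · simp
  · intro q hq
    rcases List.mem_append.1 hq with hq | hq
    · exact hE.walks q hq
    · rw [List.mem_singleton.1 hq]; exact hE.walk
  · rw [List.flatMap_append, List.flatMap_singleton, encodePath]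
    refine View.Written.append (hE.written.congr fun j hj => ?_) ?_
    · have : 5 + 4 * I.m + j ≠ a := by omega
      simp [this]
    · have h2 : ((h.setCell a p.length).set .i (Ps.length + 1)).Written (a + 1)
          (p.map fun e : Fin I.m => ((e : ℕ) : ℤ)) := by
        have hpath : h.Written (a + 1) (p.map fun e : Fin I.m => ((e : ℕ) : ℤ)) := hV.path
        refine hpath.congr fun j hj => ?_
        have : a + 1 + j ≠ a := by omega
        simp [this]
      refine View.Written.append (l := [(p.length : ℤ)]) (fun j hj => ?_) h2
      have : j = 0 := by simpa using hj
      subst this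
      simp [ha]
  · simp only [View.reg_set, View.reg_setCell, reduceCtorEq, if_false, hV.o]
    simp [encodePath]
    omega

theorem decompose_wp {c₀ : Fin I.m → ℤ} {p1 : Fin I.n → ℤ} (ht : ∀ e, 0 < c₀ e → Tight p1 e)
    (hflow : ∀ u, net c₀ u = I.k * unit I.s I.t u) (h0 : ∀ e, 0 ≤ c₀ e) {h : View} (hb : Base I h)
    (hc : ∀ e : Fin I.m, h.arr .c e = c₀ e) :
    WP decompose (400 * (I.k + 1) * (I.m + 1) ^ 2) h fun h' =>
      ∃ Ps : List (List (Fin I.m)), Ps.length = I.k ∧ Emitted I c₀ Ps h' := by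
  have hC : emit.cost ≤ 80 := by decide
  have hB : (Bx.not (.eq Var.v Var.t)).cost = 8 := rfl
  have hB' : (Bx.lt Var.i Var.k).cost = 6 := rfl
  have c1 : (Stmt.seq (.set .o Var.base) (.set .i (.lit 0))).cost = 7 := rfl
  have c2 : beginPath.cost ≤ 30 := by decide
  have c3 : endPath.cost ≤ 30 := by decide
  refine (WP.seq ((Stmt.sound _ _ (fun h' => Emitted I c₀ [] h') ?_).mono c1.le fun h₁ hh₁ =>
    WP.loop_range
      (B := beginPath.cost + ((I.m + 1) * (100 * (I.m + 1) + emit.cost + 8 + 2) + endPath.cost))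
      (M := I.k) (fun i h' =>
        ∃ Ps : List (List (Fin I.m)), Ps.length = i ∧ Emitted I c₀ Ps h') ?_ ?_ ?_)).mono ?_
        fun _ hh => hh
  · simp only [Stmt.wp, Ex.Ok, Ex.eval, true_and]
    refine ⟨⟨?_, ?_, ?_, ?_, ?_, ?_, rfl, ?_⟩, ?_⟩
    · exact hb.congr (by simp [globals]) rfl
    · intro e; simp [hc, h0]
    · intro e; simp [hc]
    · intro u
      simp only [View.arr_set, hc]
      rw [hflow u]
      simp
      ring
    · simp
    · simp
    · intro j hj; simp at hj
    · simp [hb.base]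
  · rintro i h₂ hi ⟨Ps, rfl, hE⟩
    simp only [Bx.Ok, Bx.Holds, Ex.Ok, Ex.eval, hE.i, hE.base.k, true_and]
    omega
  · rintro i h₂ hi ⟨Ps, rfl, hE⟩
    refine WP.seq ((Stmt.sound _ _ _ (beginPath_wp hE)).mono le_rfl fun h₃ hh₃ => WP.seq
      (WP.mono (WP.loop (N := I.m) (B := 100 * (I.m + 1) + emit.cost) (Q := fun h' =>
        ∃ p, Emitting I c₀ Ps p I.t h' ∧ EmittingVars I Ps p I.t h') (fun N h' => ∃ p x,
        N = I.m - p.length ∧ Emitting I c₀ Ps p x h' ∧ EmittingVars I Ps p x h') ?_ ?_ ?_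
          ⟨[], I.s, by simp, hh₃.1, hh₃.2⟩) (by rw [hB]) fun h₄ hh₄ => ?_))
    · intro N h' _
      simp [Bx.Ok, Ex.Ok]
    · rintro N h₄ ⟨p, x, rfl, hE', hV⟩ hne
      simp only [Bx.Holds, Ex.eval, hV.v, hE'.base.t] at hne
      have hx : x ≠ I.t := fun hc => hne (by rw [hc])
      refine WP.seq ((pick_wp hE'.base hV.v (hE'.exists_edge hi hx)).mono le_rfl ?_)
      rintro h₅ ⟨hf, e, hbe, hsrc, hpos⟩
      have hE₅ : Emitting I c₀ Ps p x h₅ := by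
        refine ⟨hE'.base.congr (fun y hy => hf.reg y ?_) hf.cell, ?_, ?_, ?_, ?_, hE'.walks,
          hE'.walk, ?_⟩
        · simp only [globals, List.mem_cons, List.not_mem_nil, or_false] at hy
          rcases hy with rfl | rfl | rfl | rfl | rfl <;> simp
        · rw [hf.arr]; exact hE'.nonneg
        · rw [hf.arr]; exact hE'.total
        · rw [hf.arr]; exact hE'.flow
        · rw [hf.reg _ (by simp)]; exact hE'.i
        · exact hE'.written.congr fun j _ => by rw [hf.cell]
      have hV₅ : EmittingVars I Ps p x h₅ := by
        refine ⟨?_, ?_, ?_, ?_, hV.path.congr fun j _ => by rw [hf.cell]⟩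
        · rw [hf.reg _ (by simp)]; exact hV.v
        · rw [hf.reg _ (by simp)]; exact hV.len
        · rw [hf.reg _ (by simp)]; exact hV.q
        · rw [hf.reg _ (by simp)]; exact hV.o
      refine (Stmt.sound _ _ _ (emit_wp hE₅ hV₅ hbe hsrc (by rwa [hf.arr]))).mono le_rfl ?_
      rintro h₆ ⟨hE₆, hV₆⟩
      have := hE₆.length_le ht
      refine ⟨_, ?_, _, _, rfl, hE₆, hV₆⟩
      simp only [List.length_append, List.length_singleton] at this ⊢
      omega
    · rintro N h₄ ⟨p, x, rfl, hE', hV⟩ hne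
      simp only [Bx.Holds, Ex.eval, hV.v, hE'.base.t, not_not] at hne
      have hx : x = I.t := Fin.ext (by exact_mod_cast hne)
      subst hx
      exact ⟨p, hE', hV⟩
    · obtain ⟨p, hE', hV⟩ := hh₄
      exact (Stmt.sound _ _ _ (endPath_wp hE' hV)).mono le_rfl fun h' hh' =>
        ⟨Ps ++ [p], by simp, hh'⟩
  · exact ⟨[], rfl, hh₁⟩
  · rw [hB']
    have h1 : (I.m + 1) * (100 * (I.m + 1) + emit.cost + 8 + 2) ≤ (I.m + 1) * (200 * (I.m + 1)) :=
      Nat.mul_le_mul_left _ (by omega)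
    have h2 : 1 ≤ (I.m + 1) ^ 2 := Nat.one_le_pow _ _ (by omega)
    have h3 : (I.m + 1) * (200 * (I.m + 1)) = 200 * (I.m + 1) ^ 2 := by ring
    have h4 := Nat.mul_le_mul_left (I.k + 1) (show beginPath.cost +
      ((I.m + 1) * (100 * (I.m + 1) + emit.cost + 8 + 2) + endPath.cost) + 6 + 2 ≤
        300 * (I.m + 1) ^ 2 by omega)
    have h5 : 1 ≤ (I.k + 1) * (I.m + 1) ^ 2 := Nat.mul_pos (by omega) h2
    nlinarith

/-! ### Correctness and running time of the program -/

/-- A circulation of tight edges vanishes, because lengths are positive. -/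
theorem eq_zero_of_net_eq_zero {c : Fin I.m → ℤ} {p1 : Fin I.n → ℤ} (h0 : ∀ e, 0 ≤ c e)
    (ht : ∀ e, 0 < c e → Tight p1 e) (hc : ∀ u, net c u = 0) (e : Fin I.m) : c e = 0 := by
  have h1 := sum_mul_sub c p1
  simp only [hc, zero_mul, Finset.sum_const_zero] at h1
  have h2 : ∀ e, c e * (p1 (I.src e) - p1 (I.tgt e)) = -(c e * I.len e) := by
    intro e
    rcases (h0 e).eq_or_lt with h | h
    · simp [← h]
    · have := ht e h
      unfold Tight at this
      rw [this]; ring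
  simp only [h2, Finset.sum_neg_distrib, neg_eq_zero] at h1
  have h3 := (Finset.sum_eq_zero_iff_of_nonneg fun e _ => mul_nonneg (h0 e) (by positivity)).1 h1 e
    (Finset.mem_univ e)
  have := I.len_pos e
  rcases mul_eq_zero.1 h3 with h | h
  · exact h
  · omega

/-- At the end of the decomposition no flow is left, and the paths are an optimal solution. -/
theorem Emitted.solution (hk : 1 ≤ I.k) (hw : ∀ e, 0 ≤ I.wt e) {P : Pot I} (hf : P.Feas)
    (hv : P.Valid) {Ps : List (List (Fin I.m))} (hlen : Ps.length = I.k) {h : View}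
    (hE : Emitted I P.c Ps h) : ∃ Q : Fin I.k → List (Fin I.m), I.IsOptimal Q ∧
      I.encodePaths Q = Ps.flatMap encodePath := by
  set Q : Fin I.k → List (Fin I.m) := fun i => Ps[(i : ℕ)]'(by rw [hlen]; exact i.isLt) with hQ
  have hmap : (List.finRange I.k).map Q = Ps := by
    refine List.ext_getElem (by simp [hlen]) fun i h1 h2 => ?_
    simp [hQ]
  refine ⟨Q, isOptimal_of_feas hk hw hf hv (fun i => hE.walks _ (List.getElem_mem _))
    (fun e => ?_), ?_⟩
  · have hz : h.arr .c e = 0 := by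
      refine eq_zero_of_net_eq_zero (c := fun e : Fin I.m => h.arr .c e) (p1 := P.p1) hE.nonneg
        (fun e he => hf.tight ?_) (fun u => ?_) e
      · have h1 := hE.total e
        have h2 := sum_count_nonneg Ps e
        simp only [List.count_nil, Nat.cast_zero, add_zero] at h1
        omega
      · rw [hE.flow, hlen]; ring
    have h1 := hE.total e
    rw [hz, ← hmap, List.map_map] at h1
    rw [← h1, load, Fin.sum_univ_def]
    simp [Function.comp_def]
  · rw [← hmap, List.flatMap_map]
    refine List.flatMap_congr fun i _ => ?_
    -- `encodePaths` first casts the list to a list of natural numbers.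
    simp [encodePath, ← List.map_eq_flatMap]

theorem solver_wp (hk : 1 ≤ I.k) (hw : ∀ e, 0 ≤ I.wt e) :
    WP solver (5000 * (I.k + 1) * (I.m + 1) ^ 2) (initialView I) fun h =>
      (h.reg .res = 1 ∧ h.reg .base = (5 + 4 * I.m : ℕ) ∧ ∃ Q, I.IsOptimal Q ∧
        h.Written (5 + 4 * I.m) (I.encodePaths Q)) ∨ (h.reg .res = 0 ∧ ∀ p, ¬ I.IsPath p) := by
  have hB : (Bx.eq Var.fail (.lit 0)).cost = 5 := rfl
  have c1 : readInput.cost ≤ 100 := by decide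
  have c2 : ∀ z, (Stmt.set .res (.lit z)).cost = 3 := fun _ => rfl
  refine (WP.seq ((Stmt.sound _ _ _ readInput_wp).mono c1 fun h₁ hS => WP.seq
    ((costLoop_wp hk hS).mono le_rfl fun h₂ hS₂ => WP.seq ((mainLoop_wp hw (hS₂.mainInv hk)).mono
      le_rfl fun h₃ hM => WP.cond (T := 400 * (I.k + 1) * (I.m + 1) ^ 2 + 3) ?_ (fun hc => ?_)
        fun hc => ?_)))).mono ?_ fun _ hh => hh
  · exact ⟨trivial, trivial⟩
  · rcases hM with ⟨h1, -⟩ | hM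
    · simp only [Bx.Holds, Ex.eval] at hc
      omega
    refine WP.seq ((decompose_wp (c₀ := (pot I h₃).c) (p1 := (pot I h₃).p1)
      (fun e he => hM.feas.tight he) hM.flow hM.valid.nonneg hM.base fun e => rfl).mono le_rfl ?_)
    rintro h₄ ⟨Ps, hlen, hE⟩
    obtain ⟨Q, hQ, hQ'⟩ := hE.solution hk hw hM.feas hM.valid hlen
    refine (Stmt.sound _ _ _ ?_).mono (c2 1).le fun _ hh => hh
    simp only [Stmt.wp, Ex.Ok, Ex.eval, true_and]
    refine Or.inl ⟨by simp, by simp [hE.base.base], Q, hQ, ?_⟩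
    rw [hQ']
    exact hE.written
  · rcases hM with ⟨-, h2⟩ | hM
    · refine (Stmt.sound _ _ _ ?_).mono (show 3 ≤ _ by omega) fun _ hh => hh
      simp only [Stmt.wp, Ex.Ok, Ex.eval, true_and]
      exact Or.inr ⟨by simp, h2⟩
    · exact absurd hM.fail hc
  · rw [hB]
    have h2 : 1 ≤ (I.m + 1) ^ 2 := Nat.one_le_pow _ _ (by omega)
    have h3 : I.k * (I.m + 1) ≤ (I.k + 1) * (I.m + 1) ^ 2 :=
      Nat.mul_le_mul (by omega) (Nat.le_self_pow (by omega) _)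
    have h4 : 1 ≤ (I.k + 1) * (I.m + 1) ^ 2 := Nat.mul_pos (by omega) h2
    nlinarith

end DSPInstance

/-- One program solves every instance with nonnegative weights, in
`O(k² |E|² log² |V|)` steps (a bound that is meaningful only for `|E| ≥ 1` and `|V| ≥ 2`). -/
theorem mainTheorem1 :
    ∃ (A : Ram.Prog) (C : ℝ), ∀ I : DSPInstance, 1 ≤ I.k → (∀ e, 0 ≤ I.wt e) →
      ∃ (T : ℕ) (σ : Ram.State),
        Ram.Exec A I.initial T σ ∧ I.SolvedBy σ ∧
          (1 ≤ I.m → 2 ≤ I.n →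
            (T : ℝ) ≤ C * (I.k : ℝ) ^ 2 * (I.m : ℝ) ^ 2 * Real.log (I.n : ℝ) ^ 2) := by
  refine ⟨Ram.solver, 40000 / Real.log 2 ^ 2, fun I hk hw => ?_⟩
  obtain ⟨T, τ, h, hex, hT, hrep, hQ⟩ :=
    DSPInstance.solver_wp hk hw I.initial DSPInstance.initialView_rep
  refine ⟨T, τ, hex, ?_, fun hm hn => ?_⟩
  · have hr0 : τ.reg 0 = h.reg .res := hrep.reg .res
    have hr1 : τ.reg 1 = h.reg .base := hrep.reg .base
    rcases hQ with ⟨h1, h2, Q, hQ, hW⟩ | ⟨h1, h2⟩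
    · refine Or.inl ⟨by rw [hr0, h1], Q, hQ, fun i => ?_⟩
      have := hW i i.isLt
      rw [← hrep.cell] at this
      rw [hr1, h2]
      simpa using this
    · exact Or.inr ⟨by rw [hr0, h1], h2⟩
  · have hlog2 : 0 < Real.log 2 := Real.log_pos (by norm_num)
    have hlog : Real.log 2 ≤ Real.log I.n :=
      Real.log_le_log (by norm_num) (by exact_mod_cast hn)
    have h1 : T ≤ 40000 * (I.k ^ 2 * I.m ^ 2) := by
      have e1 : (I.m + 1) ^ 2 ≤ 4 * I.m ^ 2 := by nlinarith
      have e2 : I.k + 1 ≤ 2 * I.k ^ 2 := by nlinarith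
      calc T ≤ 5000 * (I.k + 1) * (I.m + 1) ^ 2 := hT
        _ ≤ 5000 * (2 * I.k ^ 2) * (4 * I.m ^ 2) :=
            Nat.mul_le_mul (Nat.mul_le_mul_left _ e2) e1
        _ = _ := by ring
    have h2 : (T : ℝ) ≤ 40000 * ((I.k : ℝ) ^ 2 * (I.m : ℝ) ^ 2) := by exact_mod_cast h1
    -- The logarithmic factor is only needed to be bounded below by `log 2`.
    have h3 : (1 : ℝ) ≤ Real.log I.n ^ 2 / Real.log 2 ^ 2 := by
      rw [one_le_div (by positivity)]
      exact pow_le_pow_left₀ hlog2.le hlog 2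
    calc (T : ℝ) ≤ 40000 * ((I.k : ℝ) ^ 2 * (I.m : ℝ) ^ 2) * 1 := by linarith
      _ ≤ 40000 * ((I.k : ℝ) ^ 2 * (I.m : ℝ) ^ 2) * (Real.log I.n ^ 2 / Real.log 2 ^ 2) :=
          mul_le_mul_of_nonneg_left h3 (by positivity)
      _ = _ := by ring
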